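/- **Setting.** Let $K$ be a division ring, $V\neq K$ a total valuation ring of $K$ (a subring such that $x\in V$ or $x^{-1}\in V$ for every nonzero $x\in K$), $\sigma:\mathbb Q\to\mathrm{Aut}(K)$ a group homomorphism and $K[\mathbb Q,\sigma]$ the skew group ring, with $(aX^r)(bX^s)=a\,b^{\sigma(r)}X^{r+s}$, where $b^{\sigma(r)}=\sigma(r)(b)$. For additive subgroups $I,I'$ of $K$, $O_l(I)=\{a\in K: aI\subseteq I\}$ and $II'$ is the additive subgroup generated by the products; $J(\cdot)$ is the Jacobson radical, and $\subset$ is strict inclusion. For a subgroup $G\neq 0$ of $\mathbb Q$ and additive subgroups $A_g\subseteq K$, $\bigoplus_{g\in G}A_gX^g$ is a *graded extension of $V$ in $K[G,\sigma]$* if it is a subring, $A_0=V$, and for every nonzero homogeneous $aX^g\in K[G,\sigma]$ it contains $aX^g$ or $(aX^g)^{-1}$. It is of *Type (II)* if moreover $A_gA_h^{\sigma(g)}\ne A_{g+h}$ or $A_{-g}A_{-h}^{\sigma(-g)}\neq A_{-g-h}$ for some $g,h>0$ in $G$. For $r>0$ put $H_r=\bigoplus_{i\in\mathbb Z}A_{ir}X^{ir}$,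 taken in $K[X^r,X^{-r};\sigma(r)]=K[\mathbb Zr,\sigma]$. A graded extension $A=\bigoplus_{r\in\mathbb Q}A_rX^r$ of $V$ in $K[\mathbb Q,\sigma]$ is of *Type (e)* if some $H_r$ ($r>0$) is of Type (II) and $W=\bigcup_{s\in\mathbb Q}O_l(A_s)$ satisfies $J(W)=c^{-1}W$ for some nonzero $c\in K$. A *graded map* on a subgroup $G$ of $\mathbb Q$ is a map $f:G\to\mathbb Z$ with $f(0)=0$, $f(s)+f(t)\le f(s+t)$ and $f(s)+f(-s)\ge-1$ for all $s,t\in G$; for $s\neq0$ we call a graded map $g$ on $\mathbb Zs$ *nice (with respect to $s$)* if $g(s)=0$, $g(-s)=-1$. *The numbers $l_r,k_r$.* Let $A$ be of Type (e), $J(W)=Wb^{-1}$ with $b\ne0$, and $O_l(A_t)=W$ for some $t\in\mathbb Q$. For $s\in\mathbb Q\setminus\{0\}$ let $g_s$ denote the nice map on $\mathbb Zs$ (with respect to $s$) for which there is $\beta\in K$ with $WA_s=W\beta=\beta W^{\sigma(s)}$ and $WA_{is}=Wb^{g_s(is)}\gamma_i$ for all $i\in\mathbb Z$, where $\gamma_i=\beta\beta^{\sigma(s)}\cdots\beta^{\sigma((i-1)s)}$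 and $\gamma_{-i}=(\gamma_i^{-1})^{\sigma(-is)}$ for $i\ge0$. Take a positive integer $l$ such that $O_l(A_{1/l})=W$, $H_{1/l}$ is a graded extension of $V$, and, for some $a\in K$, $A_{1/l}=Wa=aW^{\sigma(1/l)}$ and $A_{-1/l}=J(W)(a^{-1})^{\sigma(-1/l)}$. For a positive rational $r=n_1/m_1$ in lowest terms and $q=lm_1$ set $$l_r=\sup_{n\ge1}g_{1/(nq)}(r),\qquad k_r=\sup_{n\ge1}g_{-1/(nq)}(-r)$$ in $\mathbb Z\cup\{+\infty\}$; these do not depend on the choice of $l$. **Theorem 4.14.** Let $A=\bigoplus_{r\in\mathbb Q}A_rX^r$ be an additive subgroup of $K[\mathbb Q,\sigma]$ (each $A_r$ an additive subgroup of $K$) with $A_0=V$. Let $W=\bigcup_{r\in\mathbb Q}O_l(A_r)$, and assume that $O_l(A_t)=W$ for some $t\in\mathbb Q$ (so $W$ is a ring) and that $J(W)=Wb^{-1}$, where $0\ne b\in K$. Assume also that, if $A$ is a graded extension of $V$ of Type (e) (so that $l_m$ and $k_m$ are defined), then $l_m<+\infty$ or $k_m<+\infty$ for some rational $m>0$. Then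 $A$ is a graded extension of $V$ in $K[\mathbb Q,\sigma]$ of Type (e) if and only if there are a nonzero graded map $f:\mathbb Q\to\mathbb Z$ and elements $\alpha_r\in K$ $(r\in\mathbb Q)$ such that: 1. $\alpha_0=1$, and for all $r,s\in\mathbb Q$: $WA_r=Wb^{f(r)}\alpha_r$, $W\alpha_r=\alpha_rW^{\sigma(r)}$ and $(W\alpha_r)(W\alpha_s)^{\sigma(r)}=W\alpha_r\alpha_s^{\sigma(r)}=W\alpha_{r+s}$. 2. (a) If $W=V$, or $f(r)+f(-r)=-1$ for all $r\neq0$, then $A_r=Wb^{f(r)}\alpha_r$ for all $r\ne0$. (b) If $W\ne V$ and $f(r)+f(-r)=0$ for some rational $r>0$, then there is a smallest positive rational $k$ with $f(k)+f(-k)=0$, and: $A_r=Wb^{f(r)}\alpha_r$ for all $r\notin k\mathbb Z$; $\bigoplus_{j\in\mathbb Z}A_{jk}X^{jk}$ is a graded extension of $V$ in $K[X^k,X^{-k};\sigma(k)]$; and $Wb^{f(jk)-1}\alpha_{jk}\subset A_{jk}\subset Wb^{f(jk)}\alpha_{jk}$ for all $j\in\mathbb Z$. -/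

import Mathlib

open scoped Pointwise

/-!
Throughout, `K` is a division ring and a group homomorphism `σ : ℚ → Aut(K)` is given as an action
of (the multiplicative copy of) the group `ℚ` on `K` by ring automorphisms:
`σ(r)(a) = Multiplicative.ofAdd r • a`.
The skew group ring `K[ℚ, σ]` is Mathlib's `SkewMonoidAlgebra K (Multiplicative ℚ)`, in which
`aX^r = single (ofAdd r) a` and `(aX^r)(bX^s) = a σ(r)(b) X^{r+s}`.
-/

namespace GradedExt

/-! ### Subsets of a division ring -/

section DivRing

variable {K : Type*} [DivisionRing K]

/-- A total valuation ring of `K`: every nonzero `x ∈ K` satisfies `x ∈ V` or `x⁻¹ ∈ V`. -/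
def IsTotalValuationRing (V : Subring K) : Prop :=
  ∀ x : K, x ≠ 0 → x ∈ V ∨ x⁻¹ ∈ V

/-- The left order `O_l(I) = {a ∈ K | a I ⊆ I}` of an additive subgroup `I` of `K`. -/
def leftOrder (I : AddSubgroup K) : Subring K where
  carrier := {a | ∀ x ∈ I, a * x ∈ I}
  mul_mem' := fun {a b} ha hb x hx => by
    rw [mul_assoc]; exact ha _ (hb x hx)
  one_mem' := fun x hx => by simpa using hx
  add_mem' := fun {a b} ha hb x hx => by
    rw [add_mul]; exact I.add_mem (ha x hx) (hb x hx)
  zero_mem' := fun x _ => by simp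
  neg_mem' := fun {a} ha x hx => by
    rw [neg_mul]; exact I.neg_mem (ha x hx)

/-- The Jacobson radical `J(W)` of a subring `W` of `K`, as a subset of `K`. -/
def jac (W : Subring K) : Set K :=
  ((↑) : W → K) '' (Ring.jacobson W : Set W)

/-- `S x = {s x | s ∈ S}`. -/
def rmulElt (S : Set K) (x : K) : Set K := {y | ∃ s ∈ S, y = s * x}

/-- `x S = {x s | s ∈ S}`. -/
def lmulElt (x : K) (S : Set K) : Set K := {y | ∃ s ∈ S, y = x * s}

/-- The product `S T` of two additive subgroups of `K`: all finite sums of products `s t`. -/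
def prodSet (S T : Set K) : Set K := (AddSubgroup.closure (S * T) : Set K)

end DivRing

/-! ### Graded maps -/

/-- A graded map `f : G → ℤ`: `f 0 = 0`, `f s + f t ≤ f (s + t)` and `f s + f (-s) ≥ -1`. -/
def IsGradedMap {G : Type*} [AddCommGroup G] (f : G → ℤ) : Prop :=
  f 0 = 0 ∧ (∀ s t, f s + f t ≤ f (s + t)) ∧ ∀ s, f s + f (-s) ≥ -1

/-- A nice map `ℤ s → ℤ` (`s ≠ 0`), written as a function of the index `i` of `i s`: a graded map
with value `0` at `s` and `-1` at `-s`. -/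
def IsNiceMap (g : ℤ → ℤ) : Prop :=
  IsGradedMap g ∧ g 1 = 0 ∧ g (-1) = -1

/-! ### Graded extensions -/

section Skew

variable {K : Type*} [DivisionRing K] [MulSemiringAction (Multiplicative ℚ) K]

/-- `σ(r)(a)`, written `a^{σ(r)}`. -/
def sg (r : ℚ) (a : K) : K := Multiplicative.ofAdd r • a

/-- `S^{σ(r)} = σ(r)(S)`. -/
def sgSet (r : ℚ) (S : Set K) : Set K := sg r '' S

/-- The homogeneous element `a X^r` of `K[ℚ, σ]`. -/
noncomputable def mono (r : ℚ) (a : K) : SkewMonoidAlgebra K (Multiplicative ℚ) :=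
  SkewMonoidAlgebra.single (Multiplicative.ofAdd r) a

/-- The additive subgroup `⨁_{g ∈ G} A_g X^g` of `K[ℚ, σ]`, contained in `K[G, σ]`. -/
def gradedSum (G : AddSubgroup ℚ) (A : ℚ → AddSubgroup K) :
    AddSubgroup (SkewMonoidAlgebra K (Multiplicative ℚ)) where
  carrier := {x | ∀ r : ℚ, x.coeff (Multiplicative.ofAdd r) ∈ A r ∧
    (r ∉ G → x.coeff (Multiplicative.ofAdd r) = 0)}
  zero_mem' := fun r => by simp
  add_mem' := fun {x y} hx hy r => by
    refine ⟨?_, fun hr => ?_⟩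
    · simpa using (A r).add_mem (hx r).1 (hy r).1
    · simp [(hx r).2 hr, (hy r).2 hr]
  neg_mem' := fun {x} hx r => by
    refine ⟨?_, fun hr => ?_⟩
    · simpa using (hx r).1
    · simp [(hx r).2 hr]

/-- `⨁_{g ∈ G} A_g X^g` is a graded extension of `V` in `K[G, σ]`: it is a subring, for each nonzero
homogeneous element of `K[G, σ]` it contains that element or its inverse, and `A_0 = V`. -/
def IsGradedExtension (G : AddSubgroup ℚ) (V : Subring K) (A : ℚ → AddSubgroup K) : Prop :=
  (∃ S : Subring (SkewMonoidAlgebra K (Multiplicative ℚ)),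
    (S : Set (SkewMonoidAlgebra K (Multiplicative ℚ))) = gradedSum G A) ∧
  (∀ g ∈ G, ∀ a : K, a ≠ 0 →
    mono g a ∈ gradedSum G A ∨
      ∃ y ∈ gradedSum G A, y * mono g a = 1 ∧ mono g a * y = 1) ∧
  A 0 = V.toAddSubgroup

/-- Type (I): `A_g A_h^{σ(g)} = A_{g+h}` and `A_{-g} A_{-h}^{σ(-g)} = A_{-g-h}` for all positive
`g, h ∈ G`. -/
def IsTypeI (G : AddSubgroup ℚ) (V : Subring K) (A : ℚ → AddSubgroup K) : Prop :=
  IsGradedExtension G V A ∧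
  ∀ g ∈ G, ∀ h ∈ G, 0 < g → 0 < h →
    prodSet (A g) (sgSet g (A h)) = (A (g + h) : Set K) ∧
    prodSet (A (-g)) (sgSet (-g) (A (-h))) = (A (-g - h) : Set K)

/-- Type (II): one of the equalities required in Type (I) fails for some positive `g, h ∈ G`. -/
def IsTypeII (G : AddSubgroup ℚ) (V : Subring K) (A : ℚ → AddSubgroup K) : Prop :=
  IsGradedExtension G V A ∧
  ∃ g ∈ G, ∃ h ∈ G, 0 < g ∧ 0 < h ∧
    (prodSet (A g) (sgSet g (A h)) ≠ (A (g + h) : Set K) ∨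
     prodSet (A (-g)) (sgSet (-g) (A (-h))) ≠ (A (-g - h) : Set K))

/-- `H_g = ⨁_{i ∈ ℤ} A_{ig} X^{ig}` is a graded extension of `V` in `K[X^g, X^{-g}; σ(g)]` of
Type (e), where `W = O_l(A_g)`: `A_g = W a = a W^{σ(g)}`, `A_{-g} = J(W) (a⁻¹)^{σ(-g)}` and
`J(W) = W c⁻¹`. -/
def IsTypeEStep (g : ℚ) (V : Subring K) (A : ℚ → AddSubgroup K) : Prop :=
  IsGradedExtension (AddSubgroup.zmultiples g) V A ∧
  ∃ a : K, (A g : Set K) = rmulElt (leftOrder (A g)) a ∧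
    (A g : Set K) = lmulElt a (sgSet g (leftOrder (A g))) ∧
    (A (-g) : Set K) = rmulElt (jac (leftOrder (A g))) (sg (-g) a⁻¹) ∧
    ∃ c : K, c ≠ 0 ∧ jac (leftOrder (A g)) = rmulElt (leftOrder (A g)) c⁻¹

/-- `A = ⨁_{r ∈ ℚ} A_r X^r` is a graded extension of `V` in `K[ℚ, σ]` of Type (e): some `H_r`,
`r > 0`, is of Type (II), and the ring `W = ⋃_s O_l(A_s)` satisfies `J(W) = c⁻¹ W` for some `c`. -/
def IsTypeE (V : Subring K) (A : ℚ → AddSubgroup K) : Prop :=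
  IsGradedExtension ⊤ V A ∧
  ∃ r : ℚ, 0 < r ∧ IsTypeII (AddSubgroup.zmultiples r) V A ∧
    ∃ W : Subring K, (W : Set K) = ⋃ s, (leftOrder (A s) : Set K) ∧
      ∃ c : K, c ≠ 0 ∧ jac W = lmulElt c⁻¹ W

/-! ### The suprema `l_r` and `k_r` -/

/-- `β β^{σ(s)} ⋯ β^{σ((i-1)s)}` for `i ∈ ℕ` (the coefficient of `(β X^s)^i`). -/
def gammaNat (s : ℚ) (β : K) : ℕ → K
  | 0 => 1
  | i + 1 => gammaNat s β i * sg ((i : ℚ) * s) β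

/-- `γ_i = β β^{σ(s)} ⋯ β^{σ((i-1)s)}` and `γ_{-i} = (γ_i⁻¹)^{σ(-is)}` for `i ∈ ℕ`. -/
def gamma (s : ℚ) (β : K) : ℤ → K
  | Int.ofNat i => gammaNat s β i
  | Int.negSucc i => sg (-((i + 1 : ℕ) : ℚ) * s) (gammaNat s β (i + 1))⁻¹

/-- `g` is the nice map on `ℤ s` that describes `(W A_{is})_{i ∈ ℤ}`: there is a `β` with
`W A_s = W β = β W^{σ(s)}` and `W A_{is} = W b^{g(is)} γ_i` for all `i ∈ ℤ`. -/
def IsStepMap (W : Subring K) (b : K) (A : ℚ → AddSubgroup K) (s : ℚ) (g : ℤ → ℤ) : Prop :=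
  IsNiceMap g ∧
  ∃ β : K, prodSet W (A s) = rmulElt W β ∧
    rmulElt (W : Set K) β = lmulElt β (sgSet s W) ∧
    ∀ i : ℤ, prodSet W (A (i * s)) = rmulElt W (b ^ g i * gamma s β i)

/-- An admissible `l`: `H_{1/l}` is of Type (e) and `O_l(A_{1/l}) = W`. -/
def IsAdmissible (V W : Subring K) (A : ℚ → AddSubgroup K) (l : ℕ) : Prop :=
  0 < l ∧ IsTypeEStep (1 / (l : ℚ)) V A ∧ leftOrder (A (1 / (l : ℚ))) = W

/-- `l_r = sup_n g_{1/(nq)}(r)` for `r = n₁/m₁ > 0` in lowest terms and `q = l m₁`, where `l` is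
admissible; note that `r = (n n₁ l) · (1/(nq))`. The supremum does not depend on `l`, and here it is
taken over all admissible `l`. -/
noncomputable def lSup (V W : Subring K) (b : K) (A : ℚ → AddSubgroup K) (r : ℚ) : EReal :=
  sSup {x | ∃ l n : ℕ, IsAdmissible V W A l ∧ 0 < n ∧
    ∃ g : ℤ → ℤ, IsStepMap W b A (1 / ((n : ℚ) * ((l : ℚ) * (r.den : ℚ)))) g ∧
      x = ((g ((n : ℤ) * r.num * (l : ℤ)) : ℝ) : EReal)}

/-- `k_r`: the same supremum for the reversed family `C_r = A_{-r}` and `τ(r) = σ(-r)`, that is,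
with the steps `-1/(nq)` in place of `1/(nq)`. -/
noncomputable def kSup (V W : Subring K) (b : K) (A : ℚ → AddSubgroup K) (r : ℚ) : EReal :=
  sSup {x | ∃ l n : ℕ, IsAdmissible V W A l ∧ 0 < n ∧
    ∃ h : ℤ → ℤ, IsStepMap W b A (-(1 / ((n : ℚ) * ((l : ℚ) * (r.den : ℚ))))) h ∧
      x = ((h ((n : ℤ) * r.num * (l : ℤ)) : ℝ) : EReal)}

end Skew

end GradedExt

open GradedExt

/-! The homogeneous units `aX^r` form a group with a degree map to ℚ. In it a graded extension
becomes a submonoid `S` containing every element or its inverse, and `W` becomes a submonoid `P` of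
the degree-zero kernel. The nonunits of `P` are `P b⁻¹`, so a failure of multiplicativity can be
measured by an integer power of `b`.

Necessity. The module `W A_r` is generated by one element `β_r` of `A_r`
(`GradedCone.exists_isTop`), and `β_r` normalizes `W` (`GradedCone.normalizes`). The product `β_r
β_s` agrees up to a unit of `W` with `b^{-ε(r,s)} β_{r+s}`, where `ε` takes the values 0 and 1
(`GradedCone.assoc_mul_top`). Since `b` commutes with the `β_r` up to units of `W`, associativity
makes `ε` a two-cocycle. If `ε(r,s) = f(r+s) - f(r) - f(s)`, then `f` is a graded map and `α_r =
b^{-f(r)} β_r` is multiplicative up to units. So everything rests on splitting `ε`. On each cyclic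
subgroup `ℤs` it splits uniquely once the value at `s` is fixed to be 0; when `ε(s,-s) = 1` this
splitting is the nice map `g_s`. Refining the step can only increase the value at a fixed positive
rational, so finiteness of `l_m` (or of `k_m`, after reversing signs) makes the splittings stabilize
and glue (`IsExtCocycle.exists_splitting`).

The shape of `A_r` depends on `ε(r,-r) = -(f(r) + f(-r))`. If it is 1, then `A_r = W β_r`. If it is
0 and `W ≠ V`, then `A_r` lies strictly between `J(W) β_r` and `W β_r`. The degrees of the second
kind form a subgroup on which `f` is additive; as `f` is nonzero and integer-valued, this subgroup
is discrete (`IsGradedMap.exists_isLeast`).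

Sufficiency. The inequalities for `f` give closure under products and the inverse condition. A
product of two factors from outside the exceptional subgroup that lands inside it loses a factor of
`b`, hence falls into `J(W)` times the generator. Type (II) holds because a graded map additive on
each half-line is additive into ℤ on divisible cones, hence zero. -/

/-! ### Cones in a group with a degree map -/

namespace GradedExt

section Cone

variable {G D : Type*} [Group G] [Group D]

/-- The group-theoretic shadow of a total valuation ring `P` whose nonunits are `P b⁻¹`: a submonoid
`P` of the kernel of `π` that contains every kernel element or its inverse. -/
structure ValCone (π : G →* D) (P : Set G) (b : G) : Prop where
  ker : ∀ {x}, x ∈ P → π x = 1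
  one : (1 : G) ∈ P
  mul : ∀ {x y}, x ∈ P → y ∈ P → x * y ∈ P
  total : ∀ {x}, π x = 1 → x ∈ P ∨ x⁻¹ ∈ P
  gen : ∀ {x}, x * b ∈ P ↔ x ∈ P ∧ x⁻¹ ∉ P

/-- `u` normalizes `P`. -/
def Normalizes (P : Set G) (u : G) : Prop := ∀ x, u * x * u⁻¹ ∈ P ↔ x ∈ P

/-- `u` and `v` differ by a unit of `P` on the left. -/
def Assoc (P : Set G) (u v : G) : Prop := u * v⁻¹ ∈ P ∧ v * u⁻¹ ∈ P

namespace Normalizes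

variable {P : Set G} {u v : G}

lemma one : Normalizes P (1 : G) := fun x => by simp

lemma mul (hu : Normalizes P u) (hv : Normalizes P v) : Normalizes P (u * v) := fun x => by
  rw [← hv x, ← hu (v * x * v⁻¹)]
  simp only [mul_inv_rev, mul_assoc]

lemma inv (hu : Normalizes P u) : Normalizes P u⁻¹ := fun x => by
  rw [← hu]
  simp [mul_assoc]

lemma pow (hu : Normalizes P u) (n : ℕ) : Normalizes P (u ^ n) := by
  induction n with
  | zero => simpa using one
  | succ n ih => rw [pow_succ]; exact ih.mul hu

lemma zpow (hu : Normalizes P u) (n : ℤ) : Normalizes P (u ^ n) := by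
  cases n with
  | ofNat n => simpa using hu.pow n
  | negSucc n => simpa using (hu.pow (n + 1)).inv

lemma of_conj (h1 : ∀ x ∈ P, u * x * u⁻¹ ∈ P) (h2 : ∀ x ∈ P, u⁻¹ * x * u ∈ P) :
    Normalizes P u := fun x => ⟨fun hx => by simpa [mul_assoc] using h2 _ hx, h1 x⟩

lemma conj_inv (hu : Normalizes P u) (x : G) : u⁻¹ * x * u ∈ P ↔ x ∈ P := by
  simpa using hu.inv x

end Normalizes

namespace Assoc

variable {P : Set G} {u v w : G}

lemma symm (h : Assoc P u v) : Assoc P v u := ⟨h.2, h.1⟩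

lemma mul_right (h : Assoc P u v) (w : G) : Assoc P (u * w) (v * w) := by
  simpa [Assoc, mul_assoc] using h

lemma mul_left (h : Assoc P u v) (hw : Normalizes P w) : Assoc P (w * u) (w * v) := by
  refine ⟨?_, ?_⟩
  · have := (hw _).2 h.1; simpa [mul_assoc] using this
  · have := (hw _).2 h.2; simpa [mul_assoc] using this

end Assoc

namespace ValCone

variable {π : G →* D} {P : Set G} {b : G}

lemma map_gen (h : ValCone π P b) : π b = 1 := by
  have h1 : b⁻¹ ∈ P := (h.gen.1 (by simpa using h.one)).1
  simpa using h.ker h1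

lemma inv_gen_mem (h : ValCone π P b) : b⁻¹ ∈ P := (h.gen.1 (by simpa using h.one)).1

lemma gen_notMem (h : ValCone π P b) : b ∉ P := by
  have h1 := (h.gen (x := b⁻¹)).1 (by simpa using h.one)
  simpa using h1.2

/-- If `x` is a nonunit and `b * x ∉ P`, then `(b * x)⁻¹` is itself a nonunit of `P`, and
multiplying it by `b` on the right gives `x⁻¹ ∈ P`, a contradiction. Thus the one-sided generator is
two-sided, which is what makes `b` normalize `P`. -/
lemma left_gen (h : ValCone π P b) {x : G} : b * x ∈ P ↔ x ∈ P ∧ x⁻¹ ∉ P := by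
  constructor
  · intro hx
    have h1 : x ∈ P := by simpa using h.mul h.inv_gen_mem hx
    refine ⟨h1, fun h2 => h.gen_notMem ?_⟩
    simpa using h.mul hx h2
  · intro hx
    by_contra hb
    have h1 : (b * x)⁻¹ ∈ P :=
      (h.total (by rw [map_mul, h.map_gen, h.ker hx.1, one_mul])).resolve_left hb
    have h2 := (h.gen (x := (b * x)⁻¹)).2 ⟨h1, by simpa using hb⟩
    exact hx.2 (by simpa using h2)

lemma left_gen_iff (h : ValCone π P b) {x : G} : b * x ∈ P ↔ x * b ∈ P :=
  h.left_gen.trans h.gen.symm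

lemma nonunit_mul (h : ValCone π P b) {x y : G} (hx : x * b ∈ P) (hy : y ∈ P) :
    x * y * b ∈ P := by
  rw [← h.left_gen_iff] at hx ⊢
  simpa [mul_assoc] using h.mul hx hy

lemma mul_nonunit (h : ValCone π P b) {x y : G} (hx : x ∈ P) (hy : y * b ∈ P) :
    x * y * b ∈ P := by
  simpa [mul_assoc] using h.mul hx hy

lemma nonunit_of_inv_notMem (h : ValCone π P b) {x : G} (hx : π x = 1) (hx' : x⁻¹ ∉ P) :
    x * b ∈ P := h.gen.2 ⟨(h.total hx).resolve_right hx', hx'⟩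

lemma gen_normalizes (h : ValCone π P b) : Normalizes P b := fun x => by
  constructor
  · intro hx
    have : b * (x * b⁻¹) ∈ P := by simpa [mul_assoc] using hx
    rw [h.left_gen_iff] at this
    simpa using this
  · intro hx
    have : x * b⁻¹ * b ∈ P := by simpa using hx
    rw [← h.left_gen_iff] at this
    simpa [mul_assoc] using this

lemma assoc_refl (h : ValCone π P b) (u : G) : Assoc P u u := by
  simpa [Assoc] using h.one

lemma assoc_trans (h : ValCone π P b) {u v w : G} (h1 : Assoc P u v) (h2 : Assoc P v w) :
    Assoc P u w :=
  ⟨by simpa [mul_assoc] using h.mul h1.1 h2.1, by simpa [mul_assoc] using h.mul h2.2 h1.2⟩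

lemma assoc_mul (h : ValCone π P b) {u u' v v' : G} (hu : Normalizes P u) (h1 : Assoc P u u')
    (h2 : Assoc P v v') : Assoc P (u * v) (u' * v') :=
  h.assoc_trans (h2.mul_left hu) (h1.mul_right v')

/-- The generator `b` is central up to units of `P`. -/
lemma assoc_gen_comm (h : ValCone π P b) {u : G} (hu : Normalizes P u) :
    Assoc P (u * b) (b * u) := by
  -- Conjugation by `v` preserves nonunits, so it sends `b⁻¹` to a left multiple of `b⁻¹`. Using
  -- this for `u` and for `u⁻¹` gives the two halves.
  have key : ∀ v, Normalizes P v → v * b⁻¹ * v⁻¹ * b ∈ P := fun v hv => by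
    rw [h.gen]
    refine ⟨(hv _).2 h.inv_gen_mem, fun h1 => h.gen_notMem ?_⟩
    rw [← hv]
    simpa [mul_assoc] using h1
  constructor
  · have h3 := key u⁻¹ hu.inv
    rw [← hu] at h3
    rw [← h.gen_normalizes.conj_inv]
    have e : b⁻¹ * (u * b * (b * u)⁻¹) * b = b⁻¹ * (u * b * u⁻¹) := by group
    rw [e]
    have e3 : u * (u⁻¹ * b⁻¹ * u⁻¹⁻¹ * b) * u⁻¹ = b⁻¹ * (u * b * u⁻¹) := by group
    rwa [e3] at h3
  · have h3 := key u hu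
    rw [← h.gen_normalizes] at h3
    have e : b * (u * b⁻¹ * u⁻¹ * b) * b⁻¹ = b * u * (u * b)⁻¹ := by group
    rwa [e] at h3

lemma assoc_gen_zpow_comm (h : ValCone π P b) {u : G} (hu : Normalizes P u) (n : ℤ) :
    Assoc P (u * b ^ n) (b ^ n * u) := by
  induction n with
  | zero => simpa using h.assoc_refl u
  | succ n ih =>
    rw [zpow_add_one]
    have h1 := ih.mul_right b
    have h2 := (h.assoc_gen_comm hu).mul_left (h.gen_normalizes.zpow n)
    simpa [mul_assoc] using h.assoc_trans h1 (by simpa [mul_assoc] using h2)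
  | pred n ih =>
    rw [zpow_sub_one]
    have h1 := ih.mul_right b⁻¹
    have h2 := (((h.assoc_gen_comm hu).mul_right b⁻¹).mul_left h.gen_normalizes.inv).mul_left
      (h.gen_normalizes.zpow (-(n : ℤ)))
    have h3 := h2.symm
    have e1 : b ^ (-(n : ℤ)) * (b⁻¹ * (u * b * b⁻¹)) = b ^ (-(n : ℤ)) * b⁻¹ * u := by group
    have e2 : b ^ (-(n : ℤ)) * (b⁻¹ * (b * u * b⁻¹)) = b ^ (-(n : ℤ)) * u * b⁻¹ := by group
    rw [e1, e2] at h3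
    simpa [mul_assoc] using h.assoc_trans h1 h3

lemma gen_zpow_mem (h : ValCone π P b) {n : ℤ} : b ^ n ∈ P ↔ n ≤ 0 := by
  have h1 : ∀ n : ℕ, b ^ (-(n : ℤ)) ∈ P := fun n => by
    induction n with
    | zero => simpa using h.one
    | succ n ih =>
      have := h.mul ih h.inv_gen_mem
      rw [← zpow_sub_one] at this
      convert this using 2
      push_cast; ring
  have h2 : ∀ n : ℕ, b ^ ((n : ℤ) + 1) ∉ P := fun n hn => h.gen_notMem (by
    have := h.mul hn (h1 n)
    rw [← zpow_add] at this
    simpa using this)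
  constructor
  · intro hn
    by_contra hlt
    obtain ⟨m, rfl⟩ : ∃ m : ℕ, n = m + 1 := ⟨(n - 1).toNat, by omega⟩
    exact h2 m hn
  · intro hn
    obtain ⟨m, rfl⟩ : ∃ m : ℕ, n = -m := ⟨(-n).toNat, by omega⟩
    exact h1 m

lemma assoc_gen_zpow_iff (h : ValCone π P b) {m n : ℤ} {u : G} :
    Assoc P (b ^ m * u) (b ^ n * u) ↔ m = n := by
  have e : ∀ m n : ℤ, b ^ m * u * (b ^ n * u)⁻¹ = b ^ (m - n) := fun m n => by
    rw [zpow_sub]; group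
  simp only [Assoc, e, h.gen_zpow_mem]
  omega

end ValCone

end Cone

/-! ### Generators of the homogeneous parts over `P` -/

section GradedCone

variable {G D : Type*} [Group G] [Group D]

/-- The group-theoretic shadow of a graded extension: a submonoid `S` containing every element or
its inverse, for which `P` is the union of the left orders of the homogeneous parts of `S` and one
of these left orders is `P`. -/
structure GradedCone (π : G →* D) (S P : Set G) (b : G) : Prop extends ValCone π P b where
  mul_mem : ∀ {x y}, x ∈ S → y ∈ S → x * y ∈ S
  total_mem : ∀ x, x ∈ S ∨ x⁻¹ ∈ S
  leftOrder_mem : ∀ {x} d, π x = 1 → (∀ y ∈ S, π y = d → x * y ∈ S) → x ∈ P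
  exists_leftOrder : ∃ t, ∀ x ∈ P, ∀ y ∈ S, π y = t → x * y ∈ S

/-- `u` generates the `P`-module spanned by the part of `S` in the degree of `u`. -/
def IsTop (π : G →* D) (S P : Set G) (u : G) : Prop :=
  u ∈ S ∧ ∀ x ∈ S, π x = π u → x * u⁻¹ ∈ P

namespace GradedCone

variable {π : G →* D} {S P : Set G} {b : G}

lemma mem_of_inv_notMem (h : GradedCone π S P b) {x : G} (hx : x⁻¹ ∉ S) : x ∈ S :=
  (h.total_mem x).resolve_right hx

lemma one_mem (h : GradedCone π S P b) : (1 : G) ∈ S := by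
  simpa using h.total_mem 1

lemma sub (h : GradedCone π S P b) {x : G} (hx : x ∈ S) (hx1 : π x = 1) : x ∈ P :=
  h.leftOrder_mem 1 hx1 fun _ hy _ => h.mul_mem hx hy

lemma nonunit_mem (h : GradedCone π S P b) {x : G} (hx : x * b ∈ P) : x ∈ S := by
  have h1 := h.gen.1 hx
  exact h.mem_of_inv_notMem fun h2 => h1.2 (h.sub h2 (by simpa using h.ker h1.1))

/-- Without a generator, every `y` in the degree-`d` part is a nonunit times some `x` there, and `x`
is a nonunit times some `z`. One of the two nonunits absorbs `b`, so `b * y` is a nonunit times `z`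
and stays in `S`. Then `b` lies in a left order, hence in `P`, which is impossible. -/
lemma exists_isTop (h : GradedCone π S P b) (d : D) : ∃ u, π u = d ∧ IsTop π S P u := by
  by_contra hcon
  push Not at hcon
  have step : ∀ y ∈ S, π y = d → ∃ x ∈ S, π x = d ∧ y * x⁻¹ * b ∈ P := by
    intro y hy hyd
    have h1 := hcon y hyd
    simp only [IsTop, not_and, not_forall] at h1
    obtain ⟨x, hx, hxd, hxy⟩ := h1 hy
    refine ⟨x, hx, hxd.trans hyd, h.nonunit_of_inv_notMem ?_ (by simpa using hxy)⟩
    simp [hxd]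
  refine h.gen_notMem (h.leftOrder_mem d h.map_gen fun y hy hyd => ?_)
  obtain ⟨x, hx, hxd, hyx⟩ := step y hy hyd
  obtain ⟨z, hz, -, hxz⟩ := step x hx hxd
  rw [← h.left_gen_iff] at hyx
  have h1 := h.mul_nonunit hyx hxz
  have h2 := h.mul_mem (h.nonunit_mem h1) hz
  simpa [mul_assoc] using h2

lemma nonunit_mul_mem (h : GradedCone π S P b) {u x : G} (hu : IsTop π S P u) (hx : x * b ∈ P) :
    x * u ∈ S := h.mul_mem (h.nonunit_mem hx) hu.1

lemma conj_mem_of_mem (h : GradedCone π S P b) {u x : G} (hu : IsTop π S P u) (hx : x ∈ S)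
    (hx1 : π x = 1) : u * x * u⁻¹ ∈ P :=
  hu.2 _ (h.mul_mem hu.1 hx) (by simp [hx1])

lemma isTop_one (h : GradedCone π S P b) : IsTop π S P 1 :=
  ⟨h.one_mem, fun x hx hx1 => by simpa using h.sub hx (by simpa using hx1)⟩

/-- In a degree whose left order is `P`, the inverse degree is `u⁻¹ J`. -/
lemma inv_degree_nonunit (h : GradedCone π S P b) {x₀ u : G} (hx₀ : x₀ ∈ P) (hx₀S : x₀ ∉ S)
    (hu : ∀ x ∈ P, x * u ∈ S) {x : G} (hx : x ∈ S) (hxu : π x = (π u)⁻¹) :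
    u * x * b ∈ P := by
  have h1 : π (u * x) = 1 := by simp [hxu]
  refine h.nonunit_of_inv_notMem h1 fun h2 => hx₀S ?_
  have := h.mul_mem (hu _ (h.mul hx₀ h2)) hx
  simpa [mul_assoc] using this

lemma inv_mul_nonunit_mem (h : GradedCone π S P b) {u x : G} (hu : IsTop π S P u)
    (hx : x * b ∈ P) : u⁻¹ * x ∈ S := by
  refine h.mem_of_inv_notMem fun h1 => ?_
  have hx' := h.gen.1 hx
  refine hx'.2 ?_
  have := hu.2 _ h1 (by simp [h.ker hx'.1])
  simpa using this

/-- Write `J` for the nonunits of `P`. The part of `S` in the inverse degree is exactly `u⁻¹ J`,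
whose left order contains `u⁻¹ P u`; this gives one inclusion. For the other, the degree of `u²` is
examined: either that part equals `u P u`, whose left order contains `u P u⁻¹`, or it has an element
outside `u P u`, which forces `u P ⊆ S`. -/
lemma normalizes_of_leftOrder (h : GradedCone π S P b) {x₀ u : G} (hx₀ : x₀ ∈ P) (hx₀S : x₀ ∉ S)
    (hu : IsTop π S P u) (hPu : ∀ x ∈ P, x * u ∈ S) : Normalizes P u := by
  have hinv : ∀ x ∈ S, π x = (π u)⁻¹ → u * x * b ∈ P := fun x hx hxu =>
    h.inv_degree_nonunit hx₀ hx₀S hPu hx hxu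
  refine .of_conj (fun p hp => ?_) fun p hp => ?_
  · by_cases hcase : ∃ x ∈ S, π x = π u * π u ∧ u⁻¹ * x * u⁻¹ ∉ P
    · obtain ⟨x, hx, hxd, hxP⟩ := hcase
      have h1 : u⁻¹ * x * u⁻¹ ∉ P := hxP
      have h2 : (u⁻¹ * x * u⁻¹)⁻¹ * b ∈ P :=
        h.nonunit_of_inv_notMem (by simp [hxd]) (by simpa using h1)
      have h3 := h.mul_mem hx (h.inv_mul_nonunit_mem hu (h.nonunit_mul h2 hp))
      have h4 := hu.2 _ h3 (by simp [hxd, h.ker hp])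
      simpa [mul_assoc] using h4
    · push Not at hcase
      refine h.leftOrder_mem (π u * π u) (by simp [h.ker hp]) fun y hy hyd => ?_
      have h1 := h.mul_mem hu.1 (hPu _ (h.mul hp (hcase y hy hyd)))
      simpa [mul_assoc] using h1
  · refine h.leftOrder_mem (π u)⁻¹ (by simp [h.ker hp]) fun y hy hyd => ?_
    have h1 := h.inv_mul_nonunit_mem hu (h.mul_nonunit hp (hinv y hy hyd))
    simpa [mul_assoc] using h1

lemma conj_mem (h : GradedCone π S P b) {u : G} (hu : IsTop π S P u) {p : G} (hp : p ∈ P) :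
    u * p * u⁻¹ ∈ P := by
  by_cases hPS : ∀ x ∈ P, x ∈ S
  · exact h.conj_mem_of_mem hu (hPS p hp) (h.ker hp)
  push Not at hPS
  obtain ⟨x₀, hx₀, hx₀S⟩ := hPS
  obtain ⟨t, ht⟩ := h.exists_leftOrder
  obtain ⟨τ, hτt, hτ⟩ := h.exists_isTop t
  -- `τ` generates a part that is a full `P`-module. It serves as a probe: the part of degree `π u *
  -- π τ` is compared with `u P τ ⊆ S`.
  have hPτ : ∀ x ∈ P, x * τ ∈ S := fun x hx => ht x hx τ hτ.1 hτt
  have hτn := h.normalizes_of_leftOrder hx₀ hx₀S hτ hPτ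
  by_contra hz
  -- `u⁻¹ P u` is smaller than `P`
  have hsmall : ∀ q ∈ P, u⁻¹ * q * u ∈ P := by
    intro q hq
    by_contra hq'
    rcases h.total_mem (p * (u⁻¹ * q * u)⁻¹) with h1 | h1
    · have h2 := h.mul (h.conj_mem_of_mem hu h1 (by simp [h.ker hp, h.ker hq])) hq
      exact hz (by simpa [mul_assoc] using h2)
    · have h2 := h.mul (h.sub h1 (by simp [h.ker hp, h.ker hq])) hp
      exact hq' (by simpa [mul_assoc] using h2)
  -- the `P`-module generated by the part of `S` in the degree of `u` is `u P`
  have hAP : ∀ x ∈ S, π x = π u → u⁻¹ * x ∈ P := by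
    intro x hx hxu
    have := hsmall _ (hu.2 x hx hxu)
    simpa [mul_assoc] using this
  -- If the product degree is larger than `u P τ`, dividing by the extra element gives `u P ⊆ S`, so
  -- the part at `u` is `u P`. Otherwise the product degree is exactly `u P τ`. In both cases `u * p
  -- * u⁻¹` lies in a left order.
  by_cases hcase : ∃ y, y * τ ∈ S ∧ π y = π u ∧ u⁻¹ * y ∉ P
  · obtain ⟨y, hy, hyu, hyP⟩ := hcase
    have hA : ∀ q ∈ P, u * q ∈ S := by
      intro q hq
      have h1 : y⁻¹ * (u * q) * b ∈ P := by
        have : (u⁻¹ * y)⁻¹ * b ∈ P :=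
          h.nonunit_of_inv_notMem (by simp [hyu]) (by simpa using hyP)
        simpa [mul_assoc] using h.nonunit_mul this hq
      have h2 := h.mul_mem hy (h.inv_mul_nonunit_mem hτ h1)
      simpa [mul_assoc] using h2
    refine hz (h.leftOrder_mem (π u) (by simp [h.ker hp]) fun x hx hxu => ?_)
    have := hA _ (h.mul hp (hAP x hx hxu))
    simpa [mul_assoc] using this
  · push Not at hcase
    refine hz (h.leftOrder_mem (π u * π τ) (by simp [h.ker hp]) fun x hx hxd => ?_)
    have h1 := hcase (x * τ⁻¹) (by simpa using hx) (by simp [hxd])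
    have h2 := h.mul_mem hu.1 (hPτ _ (h.mul hp h1))
    simpa [mul_assoc] using h2

/-- A generator of a homogeneous part of `S` over `P` normalizes `P`. -/
theorem normalizes (h : GradedCone π S P b) {u : G} (hu : IsTop π S P u) : Normalizes P u := by
  refine .of_conj (fun p hp => h.conj_mem hu hp) ?_
  obtain ⟨v, hv1, hv⟩ := h.exists_isTop (π u)⁻¹
  have huv : u * v ∈ P := h.sub (h.mul_mem hu.1 hv.1) (by simp [hv1])
  -- If `u * v` is a unit, conjugation by `u⁻¹` is conjugation by `v` after conjugation by a unit of
  -- `P`. If not, `p * (u * v)` is a nonunit, so `u⁻¹ * p * u * v` lies in `S` and is compared with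
  -- the generator `v`.
  by_cases hunit : (u * v)⁻¹ ∈ P
  · intro p hp
    have := h.conj_mem hv (h.mul (h.mul hunit hp) huv)
    simpa [mul_assoc] using this
  · intro p hp
    have h1 := h.mul_nonunit hp (h.nonunit_of_inv_notMem (h.ker huv) hunit)
    have h2 := hv.2 _ (h.inv_mul_nonunit_mem hu h1) (by simp [hv1, h.ker hp])
    simpa [mul_assoc] using h2

lemma unit_or_gen_inv (h : GradedCone π S P b) {x : G} (hx : x ∈ P) (hx' : b⁻¹ * x⁻¹ ∈ P) :
    Assoc P x 1 ∨ Assoc P x b⁻¹ := by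
  by_cases h1 : x⁻¹ ∈ P
  · exact .inl ⟨by simpa using hx, by simpa using h1⟩
  · exact .inr ⟨by simpa using h.gen.2 ⟨hx, h1⟩, hx'⟩

/-- The element `u⁻¹ * b⁻¹` lies in `S`, so it is a `P`-multiple of `v`; conjugating by `u` gives
the claim. Consequently `u * v` is a unit or agrees with `b⁻¹` up to a unit. -/
lemma gen_inv_mul_inv_mem (h : GradedCone π S P b) {u v : G} (hu : IsTop π S P u)
    (hv : IsTop π S P v) (huv : π v = (π u)⁻¹) : b⁻¹ * (u * v)⁻¹ ∈ P := by
  have h1 := hv.2 _ (h.inv_mul_nonunit_mem hu (x := b⁻¹) (by simpa using h.one))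
    (by simp [huv, h.map_gen])
  rw [← h.normalizes hu] at h1
  simpa [mul_assoc] using h1

/-- The product of two generators is a generator up to at most one factor `b⁻¹`. -/
theorem assoc_mul_top (h : GradedCone π S P b) {u v w : G} (hu : IsTop π S P u)
    (hv : IsTop π S P v) (hw : IsTop π S P w) (huv : π w = π u * π v) :
    Assoc P (u * v) w ∨ Assoc P (u * v) (b⁻¹ * w) := by
  obtain ⟨v', hv'1, hv'⟩ := h.exists_isTop (π v)⁻¹
  have h1 := h.gen_inv_mul_inv_mem hv hv' hv'1
  -- The defect `u * v * w⁻¹` is bounded by that of `v * v'`: the product `w * v'` returns to the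
  -- degree of `u`, hence is a `P`-multiple of `u`. So at most one factor `b⁻¹` is lost.
  have h2 : w * v' * u⁻¹ ∈ P := hu.2 _ (h.mul_mem hw.1 hv'.1) (by simp [hv'1, huv])
  have h3 := (((h.normalizes hw).mul (h.normalizes hv')) _).2 h1
  have h4 := h.assoc_gen_comm ((h.normalizes hw).mul (h.normalizes hv'))
  have hx : u * v * w⁻¹ ∈ P := hw.2 _ (h.mul_mem hu.1 hv.1) (by simp [huv])
  have hx' : b⁻¹ * (u * v * w⁻¹)⁻¹ ∈ P := by
    have h5 := (h.gen_normalizes.conj_inv _).2 h4.1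
    have h6 := h.mul h5 (h.mul h3 h2)
    have e : b⁻¹ * (w * v' * b * (b * (w * v'))⁻¹) * b *
        (w * v' * (b⁻¹ * (v * v')⁻¹) * (w * v')⁻¹ * (w * v' * u⁻¹)) =
        b⁻¹ * (u * v * w⁻¹)⁻¹ := by group
    rwa [e] at h6
  rcases h.unit_or_gen_inv hx hx' with h6 | h6
  · left; simpa using h6.mul_right w
  · right; simpa using h6.mul_right w

/-- A homogeneous part whose generator has no inverse generator is a full `P`-module. -/
lemma mul_mem_of_nonunit (h : GradedCone π S P b) {u v : G} (hu : IsTop π S P u)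
    (hv : IsTop π S P v) (huv : π v = (π u)⁻¹) (hb : u * v * b ∈ P) {p : G} (hp : p ∈ P) :
    p * u ∈ S := by
  refine h.mem_of_inv_notMem fun h1 => (h.gen.1 hb).2 ?_
  have h2 := hv.2 _ h1 (by simp [huv, h.ker hp])
  rw [← h.normalizes hu] at h2
  simpa [mul_assoc] using h.mul hp h2

lemma inv_degree_nonunit_of_nonunit (h : GradedCone π S P b) {u v : G} (hu : IsTop π S P u)
    (hv : IsTop π S P v) (huv : π v = (π u)⁻¹) (hb : u * v * b ∈ P) {x : G} (hx : x ∈ S)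
    (hxu : π x = (π u)⁻¹) : u * x * b ∈ P := by
  have h2 := hv.2 _ hx (by simp [huv, hxu])
  rw [← h.normalizes hu] at h2
  simpa [mul_assoc] using h.mul_nonunit h2 hb

/-- If the part at `u` were all of `P u`, every product `u * v` with `v` of inverse degree in `S`
would be a nonunit. A unit product therefore forces a proper submodule as soon as `P` is not
contained in `S`. -/
lemma exists_mul_notMem (h : GradedCone π S P b) {x₀ u v : G} (hx₀ : x₀ ∈ P) (hx₀S : x₀ ∉ S)
    (hv : v ∈ S) (huv : π v = (π u)⁻¹) (hunit : (u * v)⁻¹ ∈ P) :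
    ∃ p ∈ P, p * u ∉ S := by
  by_contra hcon
  push Not at hcon
  exact (h.gen.1 (h.inv_degree_nonunit hx₀ hx₀S hcon hv huv)).2 hunit

lemma exists_nonunit_degree (h : GradedCone π S P b) {x₀ : G} (hx₀ : x₀ ∈ P) (hx₀S : x₀ ∉ S) :
    ∃ t, ∀ u v, IsTop π S P u → IsTop π S P v → π u = t → π v = t⁻¹ → u * v * b ∈ P := by
  obtain ⟨t, ht⟩ := h.exists_leftOrder
  exact ⟨t, fun u v hu hv hut hvt => h.inv_degree_nonunit hx₀ hx₀S
    (fun x hx => ht x hx u hu.1 hut) hv.1 (by rw [hvt, hut])⟩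

end GradedCone

end GradedCone

/-! ### Integer-valued cocycles on `ℚ` -/

/-- A nonnegative normalized two-cocycle `ℚ × ℚ → ℤ` with `ε(r, -r) ≤ 1`. -/
structure IsExtCocycle (ε : ℚ → ℚ → ℤ) : Prop where
  zero_left : ∀ r, ε 0 r = 0
  zero_right : ∀ r, ε r 0 = 0
  nonneg : ∀ r s, 0 ≤ ε r s
  neg_le : ∀ r, ε r (-r) ≤ 1
  cocycle : ∀ r s u, ε r s + ε (r + s) u = ε s u + ε r (s + u)

/-- `F` splits the restriction of `ε` to `ℤ s` and vanishes at `s`. -/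
def IsStepSplitting (ε : ℚ → ℚ → ℤ) (s : ℚ) (F : ℤ → ℤ) : Prop :=
  F 1 = 0 ∧ ∀ i j : ℤ, F (i + j) = F i + F j + ε (i * s) (j * s)

lemma exists_int_antidifference (d : ℤ → ℤ) : ∃ F : ℤ → ℤ, F 0 = 0 ∧ ∀ i, F (i + 1) = F i + d i := by
  refine ⟨fun i => (∑ k ∈ Finset.range i.toNat, d k) -
    ∑ k ∈ Finset.range (-i).toNat, d (-(k + 1)), by simp, fun i => ?_⟩
  rcases lt_or_ge i 0 with hi | hi
  · obtain ⟨n, rfl⟩ : ∃ n : ℕ, i = -(n + 1) := ⟨(-i - 1).toNat, by omega⟩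
    have e1 : (-(n + 1 : ℤ) + 1).toNat = 0 := by omega
    have e2 : (-(n + 1 : ℤ)).toNat = 0 := by omega
    have e3 : (-(-(n + 1 : ℤ) + 1)).toNat = n := by omega
    have e4 : (-(-(n + 1 : ℤ))).toNat = n + 1 := by omega
    simp only [e1, e2, e3, e4, Finset.sum_range_succ, Finset.range_zero, Finset.sum_empty]
    ring
  · obtain ⟨n, rfl⟩ : ∃ n : ℕ, i = n := ⟨i.toNat, by omega⟩
    have e1 : ((n : ℤ) + 1).toNat = n + 1 := by omega
    have e2 : (-(n : ℤ)).toNat = 0 := by omega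
    have e3 : (-((n : ℤ) + 1)).toNat = 0 := by omega
    simp only [e1, e2, e3, Int.toNat_natCast, Finset.sum_range_succ, Finset.range_zero,
      Finset.sum_empty]
    ring

namespace IsStepSplitting

variable {ε : ℚ → ℚ → ℤ} {s : ℚ} {F F' : ℤ → ℤ}

lemma map_zero (hε : IsExtCocycle ε) (hF : IsStepSplitting ε s F) : F 0 = 0 := by
  have := hF.2 0 0
  simp [hε.zero_left] at this
  exact this

lemma map_neg_one (hε : IsExtCocycle ε) (hF : IsStepSplitting ε s F) :
    F (-1) = -ε s (-s) := by
  have := hF.2 1 (-1)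
  simp [hF.map_zero hε, hF.1] at this
  linarith

lemma unique (hF : IsStepSplitting ε s F) (hF' : IsStepSplitting ε s F') : F = F' := by
  have key : ∀ i j, F (i + j) - F' (i + j) = (F i - F' i) + (F j - F' j) := fun i j => by
    rw [hF.2, hF'.2]; ring
  let φ : ℤ →+ ℤ := AddMonoidHom.mk' (fun i => F i - F' i) key
  funext i
  have h1 : φ i = i • φ 1 := by rw [← map_zsmul]; simp
  have h2 : φ 1 = 0 := by simp [φ, hF.1, hF'.1]
  rw [h2, smul_zero] at h1
  exact sub_eq_zero.1 h1

lemma isGradedMap (hε : IsExtCocycle ε) (hF : IsStepSplitting ε s F) : IsGradedMap F := by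
  refine ⟨hF.map_zero hε, fun i j => ?_, fun i => ?_⟩
  · have := hε.nonneg (i * s) (j * s)
    rw [hF.2]; omega
  · have h1 := hF.2 i (-i)
    have h2 := hε.neg_le (i * s)
    have h3 := hF.map_zero hε
    simp only [add_neg_cancel, Int.cast_neg, neg_mul] at h1
    omega

/-- Refining the step. -/
lemma refine {M : ℤ} {u : ℚ} (hs : s = M * u)
    (hF : IsStepSplitting ε s F) (hF' : IsStepSplitting ε u F') (i : ℤ) :
    F' (i * M) = F i + i * F' M := by
  have h1 : IsStepSplitting ε s (fun i => F' (i * M) - i * F' M) := by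
    refine ⟨by simp, fun i j => ?_⟩
    have e : ∀ i : ℤ, ((i * M : ℤ) : ℚ) * u = i * s := fun i => by rw [hs]; push_cast; ring
    simp only [add_mul, hF'.2, e]
    ring
  have h2 := congrFun (h1.unique hF) i
  linarith

end IsStepSplitting

namespace IsExtCocycle

variable {ε : ℚ → ℚ → ℤ}

/-- On `ℤ s` every such cocycle is a coboundary: `F` is the indefinite sum of `ε(is, s)`, and the
cocycle identity extends the recursion from increment 1 to every increment `j`. -/
lemma exists_stepSplitting (hε : IsExtCocycle ε) (s : ℚ) : ∃ F, IsStepSplitting ε s F := by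
  obtain ⟨F, h0, hF⟩ := exists_int_antidifference fun i => ε (i * s) s
  refine ⟨F, by simpa [h0, hε.zero_left] using hF 0, fun i j => ?_⟩
  have step : ∀ j : ℤ, ε (i * s) ((j + 1 : ℤ) * s) + ε (j * s) s =
      ε (i * s) (j * s) + ε ((i + j : ℤ) * s) s := fun j => by
    have := hε.cocycle (i * s) (j * s) s
    have e1 : (i : ℚ) * s + j * s = (i + j : ℤ) * s := by push_cast; ring
    have e2 : (j : ℚ) * s + s = (j + 1 : ℤ) * s := by push_cast; ring
    rw [e1, e2] at this
    linarith
  induction j with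
  | zero => simp [h0, hε.zero_right]
  | succ j ih =>
    have := step j
    rw [← add_assoc, hF, hF, ih]
    push_cast at this ⊢
    linarith
  | pred j ih =>
    have h1 := step (-(j : ℤ) - 1)
    have h2 := hF (-(j : ℤ) - 1)
    have h3 := hF (i + (-(j : ℤ) - 1))
    have e : i + (-(j : ℤ) - 1) + 1 = i + -j := by ring
    rw [sub_add_cancel] at h1 h2
    rw [e] at h3
    rw [h3] at ih
    linarith

lemma symm_neg (hε : IsExtCocycle ε) (r : ℚ) : ε (-r) r = ε r (-r) := by
  have := hε.cocycle r (-r) r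
  simp [hε.zero_left, hε.zero_right] at this
  exact this.symm

/-- Two nonnegative terms add up to `ε(r,-r)` in the cocycle identity for `(x, r, -r)`. -/
lemma eq_zero_of_neg (hε : IsExtCocycle ε) {r : ℚ} (hr : ε r (-r) = 0) (x : ℚ) : ε x r = 0 := by
  have h1 := hε.cocycle x r (-r)
  rw [hr, add_neg_cancel, hε.zero_right] at h1
  have := hε.nonneg x r
  have := hε.nonneg (x + r) (-r)
  omega

/-- The degrees `r` with `ε(r, -r) = 0`. -/
def kernel (hε : IsExtCocycle ε) : AddSubgroup ℚ where
  carrier := {r | ε r (-r) = 0}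
  zero_mem' := hε.zero_left _
  neg_mem' := fun {r} hr => by simpa [hε.symm_neg] using hr
  add_mem' := fun {r s} hr hs => by
    have h1 := hε.cocycle (-(r + s)) r s
    have e : -(r + s) + r = -s := by ring
    rw [hε.eq_zero_of_neg hr, e, hε.symm_neg, hs, hε.eq_zero_of_neg hs] at h1
    show ε (r + s) (-(r + s)) = 0
    rw [← hε.symm_neg]
    linarith

lemma mem_kernel (hε : IsExtCocycle ε) {r : ℚ} : r ∈ hε.kernel ↔ ε r (-r) = 0 := Iff.rfl

lemma reverse (hε : IsExtCocycle ε) : IsExtCocycle fun r s => ε (-r) (-s) where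
  zero_left r := by simp [hε.zero_left]
  zero_right r := by simp [hε.zero_right]
  nonneg r s := hε.nonneg _ _
  neg_le r := hε.neg_le _
  cocycle r s u := by simpa [neg_add_rev, add_comm] using hε.cocycle (-r) (-s) (-u)

/-- If the values at a fixed positive rational of the step splittings stay bounded under
refinement of the steps, the cocycle splits on all of `ℚ`. -/
theorem exists_splitting (hε : IsExtCocycle ε) {q p : ℕ} (hq : 0 < q) (hp : 0 < p) (C : ℤ)
    (hC : ∀ n : ℕ, 0 < n → ∀ F, IsStepSplitting ε (1 / ((n : ℚ) * q)) F → F (n * p) ≤ C) :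
    ∃ f : ℚ → ℤ, ∀ r s, f (r + s) = f r + f s + ε r s := by
  choose Fs hFs using hε.exists_stepSplitting
  -- step splittings for the steps `1 / n`
  let F : ℕ → ℤ → ℤ := fun n => Fs (1 / (n : ℚ))
  have hF : ∀ n : ℕ, IsStepSplitting ε (1 / (n : ℚ)) (F n) := fun n => hFs _
  have hrefine : ∀ n M : ℕ, 0 < n → 0 < M → ∀ i : ℤ,
      F (n * M) (i * M) = F n i + i * F (n * M) M := fun n M hn hM i => by
    refine (hF n).refine ?_ (hF (n * M)) i
    push_cast
    field_simp
  -- With `F 1 = 0` and `ε ≥ 0`, the splitting is nonnegative at positive indices. By `hrefine`,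
  -- values at a fixed positive rational can only grow when the step is refined.
  have hnonneg : ∀ n M : ℕ, 0 < n → 0 < M → 0 ≤ F (n * M) M := fun n M _ _ => by
    have : ∀ k : ℕ, 0 ≤ F (n * M) (k + 1) := fun k => by
      induction k with
      | zero => simp [(hF _).1]
      | succ k ih =>
        have := (hF (n * M)).2 (k + 1) 1
        have h1 := hε.nonneg (((k + 1 : ℤ) : ℚ) * (1 / ((n * M : ℕ) : ℚ)))
          (((1 : ℤ) : ℚ) * (1 / ((n * M : ℕ) : ℚ)))
        rw [(hF _).1] at this
        push_cast at this h1 ih ⊢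
        linarith
    obtain ⟨k, rfl⟩ : ∃ k, M = k + 1 := ⟨M - 1, by omega⟩
    exact_mod_cast this k
  have hbound : ∀ n : ℕ, 0 < n → F (n * q) (n * p) ≤ C := fun n hn =>
    hC n hn _ (by simpa using hF (n * q))
  -- a step at which the maximal value is attained
  obtain ⟨n, hn, hmax⟩ : ∃ n : ℕ, 0 < n ∧ ∀ m : ℕ, 0 < m → F (m * q) (m * p) ≤ F (n * q) (n * p) := by
    obtain ⟨B, ⟨n, hn, rfl⟩, hB⟩ := Int.exists_greatest_of_bdd
      (P := fun z => ∃ n : ℕ, 0 < n ∧ z = F (n * q) (n * p))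
      ⟨C, by rintro z ⟨n, hn, rfl⟩; exact hbound n hn⟩ ⟨_, 1, one_pos, rfl⟩
    exact ⟨n, hn, fun m hm => hB _ ⟨m, hm, rfl⟩⟩
  have hNpos : 0 < n * q := Nat.mul_pos hn hq
  obtain ⟨N, hN⟩ : ∃ N, N = n * q := ⟨_, rfl⟩
  rw [← hN] at hNpos hmax
  -- Refining the maximal step by `M` adds `n * p * F (N * M) M` to the maximal value. Since `n * p
  -- > 0`, this correction vanishes, and from here on refinement changes nothing.
  have hzero : ∀ M : ℕ, 0 < M → F (N * M) M = 0 := fun M hM => by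
    have h1 := hmax (n * M) (Nat.mul_pos hn hM)
    have h2 := hrefine N M hNpos hM (n * p)
    have e1 : n * M * q = N * M := by rw [hN]; ring
    have e2 : ((n * M : ℕ) : ℤ) * p = n * p * M := by push_cast; ring
    rw [e1, e2, h2] at h1
    have h3 := hnonneg N M hNpos hM
    have h4 : (0 : ℤ) < n * p := by positivity
    nlinarith
  have hstep : ∀ M M' : ℕ, 0 < M → 0 < M' → F (N * M * M') M' = 0 := fun M M' hM hM' => by
    have h1 := hrefine (N * M) M' (Nat.mul_pos hNpos hM) hM' M
    have h2 := hzero (M * M') (Nat.mul_pos hM hM')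
    push_cast at h2
    rw [← mul_assoc, h1, hzero M hM, zero_add] at h2
    exact (mul_eq_zero.1 h2).resolve_left (by exact_mod_cast hM.ne')
  have hindep : ∀ M M' : ℕ, 0 < M → 0 < M' → ∀ i : ℤ,
      F (N * M * M') (i * M') = F (N * M) i := fun M M' hM hM' i => by
    rw [hrefine _ _ (Nat.mul_pos hNpos hM) hM', hstep M M' hM hM', mul_zero, add_zero]
  -- `f r` is the stabilized value at `r`, read off at the step `1 / (N * r.den)`, of which `r` is
  -- the multiple with index `r.num * N`.
  refine ⟨fun r => F (N * r.den) (r.num * N), fun r s => ?_⟩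
  -- common denominators
  have hval : ∀ (r : ℚ) (M : ℕ), 0 < M → ∀ i : ℤ, (i : ℚ) * (1 / ((N * M : ℕ) : ℚ)) = r →
      F (N * r.den) (r.num * N) = F (N * M) i := fun r M hM i hi => by
    rw [← hindep r.den M r.den_pos hM, ← hindep M r.den hM r.den_pos]
    have e1 : N * M * r.den = N * r.den * M := by ring
    rw [e1]
    congr 1
    have h1 : (i : ℚ) = r * (N * M) := by
      rw [← hi]; push_cast; field_simp
    have h2 : (i : ℚ) * r.den = r.num * N * M := by
      rw [h1]
      nth_rw 1 [← Rat.num_div_den r]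
      have := r.den_pos.ne'
      field_simp
    exact_mod_cast h2.symm
  have hM : 0 < r.den * s.den := Nat.mul_pos r.den_pos s.den_pos
  have hr : ((r.num * N * s.den : ℤ) : ℚ) * (1 / ((N * (r.den * s.den) : ℕ) : ℚ)) = r := by
    have := r.den_pos.ne'
    have := s.den_pos.ne'
    conv_rhs => rw [← Rat.num_div_den r]
    push_cast
    field_simp
  have hs : ((s.num * N * r.den : ℤ) : ℚ) * (1 / ((N * (r.den * s.den) : ℕ) : ℚ)) = s := by
    have := r.den_pos.ne'
    have := s.den_pos.ne'
    conv_rhs => rw [← Rat.num_div_den s]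
    push_cast
    field_simp
  have hrs := (hF (N * (r.den * s.den))).2 (r.num * N * s.den) (s.num * N * r.den)
  rw [hr, hs] at hrs
  show F (N * (r + s).den) ((r + s).num * N) = F (N * r.den) (r.num * N) +
    F (N * s.den) (s.num * N) + ε r s
  rw [hval r _ hM _ hr, hval s _ hM _ hs,
    hval (r + s) _ hM (r.num * N * s.den + s.num * N * r.den) (by
    rw [Int.cast_add, add_mul, hr, hs]), hrs]

end IsExtCocycle

/-! ### Graded maps on ℚ -/

namespace IsGradedMap

variable {f : ℚ → ℤ}

lemma isExtCocycle (hf : IsGradedMap f) : IsExtCocycle fun r s => f (r + s) - f r - f s where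
  zero_left r := by simp [hf.1]
  zero_right r := by simp [hf.1]
  nonneg r s := by have := hf.2.1 r s; omega
  neg_le r := by have := hf.2.2 r; simp only [add_neg_cancel, hf.1]; omega
  cocycle r s u := by simp only [add_assoc]; ring

lemma add_neg_eq (hf : IsGradedMap f) (r : ℚ) : f r + f (-r) = 0 ∨ f r + f (-r) = -1 := by
  have h1 := hf.2.2 r
  have h2 := hf.2.1 r (-r)
  rw [add_neg_cancel, hf.1] at h2
  omega

lemma mem_kernel (hf : IsGradedMap f) {r : ℚ} :
    r ∈ hf.isExtCocycle.kernel ↔ f r + f (-r) = 0 := by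
  rw [IsExtCocycle.mem_kernel]
  simp only [add_neg_cancel, hf.1]
  omega

lemma map_add (hf : IsGradedMap f) {r : ℚ} (hr : f r + f (-r) = 0) (x : ℚ) :
    f (x + r) = f x + f r := by
  have := hf.isExtCocycle.eq_zero_of_neg (hf.mem_kernel.2 hr) x
  omega

lemma map_int_mul (hf : IsGradedMap f) {r : ℚ} (hr : f r + f (-r) = 0) (n : ℤ) :
    f (n * r) = n * f r := by
  let φ : hf.isExtCocycle.kernel →+ ℤ := AddMonoidHom.mk' (fun x => f x)
    fun x y => by simpa using hf.map_add (hf.mem_kernel.1 y.2) x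
  have := map_zsmul φ n ⟨r, hf.mem_kernel.2 hr⟩
  simpa [φ] using this

lemma nat_mul_le (hf : IsGradedMap f) (n : ℕ) (x : ℚ) : n * f x ≤ f (n * x) := by
  induction n with
  | zero => simp [hf.1]
  | succ n ih =>
    have := hf.2.1 (n * x) x
    have e : (n : ℚ) * x + x = (n + 1 : ℕ) * x := by push_cast; ring
    rw [e] at this
    push_cast at this ⊢
    linarith

/-- Every rational has a positive multiple `n * x` in `ℤ r`, where `f` vanishes and translations
leave `f` unchanged. Superadditivity gives `f x ≤ 0`. If `f x < 0`, then `f (-x) ≥ 0`, and `x =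
(n-1)(-x) + n x` gives `f x ≥ 0`, a contradiction. -/
lemma eq_zero_of_map_eq_zero (hf : IsGradedMap f) {r : ℚ} (hr : f r + f (-r) = 0) (hr0 : r ≠ 0)
    (hfr : f r = 0) : f = 0 := by
  have hmul : ∀ x : ℚ, ∃ n : ℕ, 0 < n ∧ f (n * x) = 0 ∧ f (n * x) + f (-(n * x)) = 0 := by
    intro x
    have hrn : r.num ≠ 0 := Rat.num_ne_zero.2 hr0
    obtain ⟨n, m, hn, hnm⟩ : ∃ (n : ℕ) (m : ℤ), 0 < n ∧ (n : ℚ) * x = m * r := by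
      -- The square makes the multiplier a positive natural number whatever the sign of `r`.
      refine ⟨x.den * r.num.natAbs ^ 2, x.num * r.num * r.den, ?_, ?_⟩
      · have := Int.natAbs_pos.2 hrn
        have := x.den_pos
        positivity
      · have h1 : ((r.num.natAbs : ℕ) : ℚ) ^ 2 = (r.num : ℚ) ^ 2 := by
          rw [Nat.cast_natAbs, Int.cast_abs, sq_abs]
        have h2 := Rat.mul_den_eq_num x
        have h3 := Rat.mul_den_eq_num r
        push_cast
        rw [h1, ← h2, sq]
        nth_rw 1 [← h3]
        ring
    refine ⟨n, hn, ?_⟩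
    rw [hnm, ← hf.mem_kernel, hf.map_int_mul hr, hfr, mul_zero]
    refine ⟨rfl, ?_⟩
    have := hf.isExtCocycle.kernel.zsmul_mem (hf.mem_kernel.2 hr) m
    simpa using this
  have hle : ∀ x, f x ≤ 0 := fun x => by
    obtain ⟨n, hn, h0, -⟩ := hmul x
    have h1 := hf.nat_mul_le n x
    rw [h0] at h1
    have : (0 : ℤ) < n := by exact_mod_cast hn
    nlinarith
  funext x
  refine le_antisymm (hle x) ?_
  by_contra hlt
  push Not at hlt
  obtain ⟨n, hn, h0, h1⟩ := hmul x
  have h2 := hf.map_add h1 (((n - 1 : ℕ) : ℚ) * -x)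
  have e : ((n - 1 : ℕ) : ℚ) * -x + n * x = x := by
    rw [Nat.cast_sub hn]; push_cast; ring
  rw [e, h0] at h2
  have h3 := hf.nat_mul_le (n - 1) (-x)
  have h4 := hf.2.2 x
  have h5 : (0 : ℤ) ≤ f (-x) := by
    simp only [Pi.zero_apply] at hlt; omega
  have h6 : (0 : ℤ) ≤ ((n - 1 : ℕ) : ℤ) * f (-x) := by positivity
  simp only [Pi.zero_apply] at hlt
  linarith

/-- On the subgroup where `f r + f (-r) = 0` the map is linear, with nonzero slope by
`eq_zero_of_map_eq_zero`. Minimizing `r > 0` there thus amounts to minimizing the natural number `|f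
r|`. -/
lemma exists_isLeast (hf : IsGradedMap f) (hf0 : f ≠ 0) {r : ℚ} (hr : 0 < r)
    (hfr : f r + f (-r) = 0) : ∃ k, IsLeast {r : ℚ | 0 < r ∧ f r + f (-r) = 0} k := by
  classical
  have hex : ∃ n : ℕ, ∃ r : ℚ, (0 < r ∧ f r + f (-r) = 0) ∧ (f r).natAbs = n :=
    ⟨_, r, ⟨hr, hfr⟩, rfl⟩
  obtain ⟨k, hk, hkn⟩ := Nat.find_spec hex
  refine ⟨k, hk, fun g hg => ?_⟩
  have hmin : (f k).natAbs ≤ (f g).natAbs := by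
    rw [hkn]; exact Nat.find_min' hex ⟨g, hg, rfl⟩
  obtain ⟨a, c, ha, hc, hac⟩ : ∃ a c : ℕ, 0 < a ∧ 0 < c ∧ (a : ℚ) * k = c * g := by
    have h1 : 0 < k / g := div_pos hk.1 hg.1
    have h2 : 0 < (k / g).num := Rat.num_pos.2 h1
    refine ⟨(k / g).den, (k / g).num.toNat, (k / g).den_pos, by omega, ?_⟩
    have h4 : (((k / g).num.toNat : ℕ) : ℚ) = (k / g).num := by
      exact_mod_cast Int.toNat_of_nonneg h2.le
    have := hg.1.ne'
    have := (k / g).den_pos.ne'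
    rw [h4]
    rw [← Rat.mul_den_eq_num]; field_simp
  have h1 := hf.map_int_mul hk.2 a
  have h2 := hf.map_int_mul hg.2 c
  have h3 : (a : ℤ) * f k = c * f g := by
    rw [← h1, ← h2]; push_cast; rw [hac]
  have h4 : a * (f k).natAbs = c * (f g).natAbs := by
    have := congrArg Int.natAbs h3
    simpa [Int.natAbs_mul] using this
  have h5 : 0 < (f g).natAbs := Int.natAbs_pos.2 fun h0 =>
    hf0 (hf.eq_zero_of_map_eq_zero hg.2 hg.1.ne' h0)
  have h6 : c ≤ a := by
    by_contra hlt
    push Not at hlt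
    nlinarith
  have h7 : (c : ℚ) ≤ a := by exact_mod_cast h6
  have h8 : (0 : ℚ) < a := by exact_mod_cast ha
  have h9 : (a : ℚ) * k ≤ a * g := by
    rw [hac]; exact mul_le_mul_of_nonneg_right h7 hg.1.le
  exact le_of_mul_le_mul_left h9 h8

lemma add_neg_eq_zero_iff (hf : IsGradedMap f) {k : ℚ}
    (hk : IsLeast {r : ℚ | 0 < r ∧ f r + f (-r) = 0} k) {r : ℚ} :
    f r + f (-r) = 0 ↔ r ∈ AddSubgroup.zmultiples k := by
  have : IsLeast {g : ℚ | g ∈ hf.isExtCocycle.kernel ∧ 0 < g} k := by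
    convert hk using 3 with g
    rw [hf.mem_kernel, and_comm]
  rw [← hf.mem_kernel, AddSubgroup.cyclic_of_min this, AddSubgroup.zmultiples_eq_closure]

/-- A graded map on `ℚ` that is additive on the positive and on the negative rationals is zero. -/
lemma eq_zero_of_additive (hf : IsGradedMap f)
    (h : ∀ r s : ℚ, 0 < r → 0 < s → f (r + s) = f r + f s ∧ f (-r - s) = f (-r) + f (-s)) :
    f = 0 := by
  have key : ∀ g : ℚ → ℤ, (∀ r s : ℚ, 0 < r → 0 < s → g (r + s) = g r + g s) →
      ∀ r, 0 < r → g r = 0 := by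
    intro g hg r hr
    have hmul : ∀ n : ℕ, ∀ x : ℚ, 0 < x → g (((n + 1 : ℕ) : ℚ) * x) = (n + 1 : ℕ) * g x := by
      intro n x hx
      induction n with
      | zero => simp
      | succ n ih =>
        have e : ((n + 1 + 1 : ℕ) : ℚ) * x = ((n + 1 : ℕ) : ℚ) * x + x := by push_cast; ring
        rw [e, hg _ _ (by positivity) hx, ih]
        push_cast; ring
    -- Dividing `r` by `|g r| + 1` shows that `|g r| + 1` divides `g r`, so `g r = 0`.
    have h1 := hmul (g r).natAbs (r / ((g r).natAbs + 1 : ℕ)) (by positivity)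
    rw [mul_div_cancel₀ _ (by positivity)] at h1
    refine Int.eq_zero_of_abs_lt_dvd (m := ((g r).natAbs + 1 : ℕ)) ⟨_, h1⟩ ?_
    push_cast
    omega
  have h1 := key f fun r s hr hs => (h r s hr hs).1
  have h2 := key (fun r => f (-r)) fun r s hr hs => by
    have := (h r s hr hs).2
    rwa [neg_add']
  funext x
  rcases lt_trichotomy x 0 with hx | rfl | hx
  · simpa using h2 (-x) (by linarith)
  · exact hf.1
  · exact h1 x hx

end IsGradedMap

/-! ### Homogeneous units of the skew group ring -/

section DivRing

variable {K : Type*} [DivisionRing K]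

lemma mem_rmulElt {S : Set K} {x y : K} (hy : y ≠ 0) : x ∈ rmulElt S y ↔ x * y⁻¹ ∈ S := by
  constructor
  · rintro ⟨s, hs, rfl⟩
    simpa [hy] using hs
  · intro h
    exact ⟨_, h, by simp [hy]⟩

lemma mem_lmulElt {S : Set K} {x y : K} (hy : y ≠ 0) : x ∈ lmulElt y S ↔ y⁻¹ * x ∈ S := by
  constructor
  · rintro ⟨s, hs, rfl⟩
    simpa [hy] using hs
  · intro h
    exact ⟨_, h, by simp [hy]⟩

lemma mem_leftOrder {I : AddSubgroup K} {a : K} : a ∈ leftOrder I ↔ ∀ x ∈ I, a * x ∈ I := Iff.rfl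

lemma le_leftOrder_toAddSubgroup (V : Subring K) : leftOrder V.toAddSubgroup = V := by
  ext a
  refine ⟨fun h => by simpa using h 1 V.one_mem, fun h x hx => V.mul_mem h hx⟩

/-- A total valuation ring is local, so its radical consists of the nonunits. The point is that `1 +
a` is a unit when `a` is a nonunit, seen by applying totality to `a * (1 + a)⁻¹`. -/
lemma mem_jac {W : Subring K} (hW : IsTotalValuationRing W) {x : K} :
    x ∈ jac W ↔ x ∈ W ∧ (x = 0 ∨ x⁻¹ ∉ W) := by
  have key : ∀ x : W, x ∈ Ring.jacobson W ↔ (x : K) = 0 ∨ (x : K)⁻¹ ∉ W := by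
    intro x
    rw [← Ideal.jacobson_bot, Ideal.mem_jacobson_iff]
    constructor
    · intro h
      by_contra hcon
      push Not at hcon
      obtain ⟨z, hz⟩ := h (-⟨_, hcon.2⟩)
      rw [Ideal.mem_bot] at hz
      have hz' := congrArg (Subtype.val : W → K) hz
      simp [mul_assoc, hcon.1] at hz'
    · intro h y
      obtain ⟨a, ha⟩ : ∃ a : K, a = y * x := ⟨_, rfl⟩
      have hne : a = 0 ∨ a⁻¹ ∉ W := by
        by_cases h0 : (y : K) = 0
        · simp [ha, h0]
        refine h.imp (fun h => by simp [ha, h]) fun h h1 => h ?_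
        rw [ha, mul_inv_rev] at h1
        simpa [mul_assoc, h0] using W.mul_mem h1 y.2
      have hunit : 1 + a ≠ 0 ∧ (1 + a)⁻¹ ∈ W := by
        rcases hne with rfl | hne
        · simp [W.one_mem]
        have ha0 : a ≠ 0 := by
          rintro rfl
          simp [W.zero_mem] at hne
        have h0 : 1 + a ≠ 0 := fun h0 => hne (by
          rw [← neg_eq_iff_add_eq_zero] at h0
          simp [← h0, W.one_mem])
        refine ⟨h0, ?_⟩
        rcases hW (a * (1 + a)⁻¹) (mul_ne_zero ha0 (inv_ne_zero h0)) with h1 | h1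
        · have e : (1 + a)⁻¹ = 1 - a * (1 + a)⁻¹ := by
            have := mul_inv_cancel₀ h0
            rw [add_mul, one_mul] at this
            exact eq_sub_of_add_eq this
          rw [e]
          exact W.sub_mem W.one_mem h1
        · rw [mul_inv_rev, inv_inv, add_mul, one_mul, mul_inv_cancel₀ ha0] at h1
          exact absurd (by simpa using W.sub_mem h1 W.one_mem) hne
      refine ⟨⟨_, hunit.2⟩, ?_⟩
      rw [Ideal.mem_bot]
      apply Subtype.ext
      have := inv_mul_cancel₀ hunit.1
      rw [mul_add, mul_one, ha] at this
      show (1 + a)⁻¹ * y * x + (1 + a)⁻¹ - 1 = 0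
      rw [ha, mul_assoc, add_comm, this, sub_self]
  constructor
  · rintro ⟨y, hy, rfl⟩
    exact ⟨y.2, (key y).1 hy⟩
  · rintro ⟨h1, h2⟩
    exact ⟨⟨x, h1⟩, (key _).2 h2, rfl⟩

end DivRing

/-- The homogeneous units `a X^r` of `K[ℚ, σ]`. -/
@[ext] structure HomogUnit (K : Type*) [DivisionRing K] where
  coef : K
  deg : ℚ
  coef_ne : coef ≠ 0

section DivRing

namespace HomogUnit

variable {K : Type*} [DivisionRing K]

instance : One (HomogUnit K) := ⟨⟨1, 0, one_ne_zero⟩⟩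

@[simp] lemma coef_one : (1 : HomogUnit K).coef = 1 := rfl
@[simp] lemma deg_one : (1 : HomogUnit K).deg = 0 := rfl

/-- The homogeneous units of degree `0` with coefficient in `W`. -/
def cone (W : Subring K) : Set (HomogUnit K) := {u | u.deg = 0 ∧ u.coef ∈ W}

/-- The homogeneous units in `⨁ A_r X^r`. -/
def homogSet (A : ℚ → AddSubgroup K) : Set (HomogUnit K) := {u | u.coef ∈ A u.deg}

/-- A nonzero element of `K` as a homogeneous unit of degree `0`. -/
def const (b : K) (hb : b ≠ 0) : HomogUnit K := ⟨b, 0, hb⟩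

@[simp] lemma coef_const (b : K) (hb : b ≠ 0) : (const b hb).coef = b := rfl
@[simp] lemma deg_const (b : K) (hb : b ≠ 0) : (const b hb).deg = 0 := rfl

lemma mem_cone {W : Subring K} {u : HomogUnit K} : u ∈ cone W ↔ u.deg = 0 ∧ u.coef ∈ W := Iff.rfl

lemma mem_homogSet {A : ℚ → AddSubgroup K} {u : HomogUnit K} :
    u ∈ homogSet A ↔ u.coef ∈ A u.deg := Iff.rfl

end HomogUnit

end DivRing

section Skew

variable {K : Type*} [DivisionRing K] [MulSemiringAction (Multiplicative ℚ) K]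

@[simp] lemma sg_mul (r : ℚ) (x y : K) : sg r (x * y) = sg r x * sg r y := smul_mul' _ _ _
@[simp] lemma sg_one (r : ℚ) : sg r (1 : K) = 1 := smul_one _
@[simp] lemma sg_zero (r : ℚ) : sg r (0 : K) = 0 := smul_zero _
@[simp] lemma sg_inv (r : ℚ) (x : K) : sg r x⁻¹ = (sg r x)⁻¹ := smul_inv'' _ _
@[simp] lemma zero_sg (x : K) : sg 0 x = x := one_smul _ x
@[simp] lemma sg_sg (r s : ℚ) (x : K) : sg r (sg s x) = sg (r + s) x := smul_smul _ _ x
@[simp] lemma sg_eq_zero {r : ℚ} {x : K} : sg r x = 0 ↔ x = 0 := smul_eq_zero_iff_eq _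

lemma mem_sgSet {r : ℚ} {S : Set K} {x : K} : x ∈ sgSet r S ↔ sg (-r) x ∈ S := by
  constructor
  · rintro ⟨y, hy, rfl⟩
    simpa using hy
  · intro h
    exact ⟨_, h, by simp⟩

namespace HomogUnit

instance : Mul (HomogUnit K) :=
  ⟨fun u v => ⟨u.coef * sg u.deg v.coef, u.deg + v.deg,
    mul_ne_zero u.coef_ne (by simpa using v.coef_ne)⟩⟩
instance : Inv (HomogUnit K) :=
  ⟨fun u => ⟨sg (-u.deg) u.coef⁻¹, -u.deg, by simpa using u.coef_ne⟩⟩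

@[simp] lemma coef_mul (u v : HomogUnit K) : (u * v).coef = u.coef * sg u.deg v.coef := rfl
@[simp] lemma deg_mul (u v : HomogUnit K) : (u * v).deg = u.deg + v.deg := rfl
@[simp] lemma coef_inv (u : HomogUnit K) : (u⁻¹).coef = sg (-u.deg) u.coef⁻¹ := rfl
@[simp] lemma deg_inv (u : HomogUnit K) : (u⁻¹).deg = -u.deg := rfl

instance : Group (HomogUnit K) := Group.ofLeftAxioms
  (fun u v w => HomogUnit.ext (by simp [mul_assoc]) (by simp [add_assoc]))
  (fun u => HomogUnit.ext (by simp) (by simp))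
  (fun u => HomogUnit.ext (by simp [u.coef_ne]) (by simp))

/-- The degree homomorphism. -/
def degHom : HomogUnit K →* Multiplicative ℚ where
  toFun u := Multiplicative.ofAdd u.deg
  map_one' := rfl
  map_mul' _ _ := rfl

lemma degHom_eq_one_iff {u : HomogUnit K} : degHom u = 1 ↔ u.deg = 0 := Iff.rfl

@[simp] lemma deg_pow (u : HomogUnit K) (n : ℕ) : (u ^ n).deg = n * u.deg := by
  induction n with
  | zero => simp
  | succ n ih => rw [pow_succ, deg_mul, ih]; push_cast; ring

@[simp] lemma deg_zpow (u : HomogUnit K) (n : ℤ) : (u ^ n).deg = n * u.deg := by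
  cases n with
  | ofNat n => simp
  | negSucc n => rw [zpow_negSucc, deg_inv, deg_pow]; push_cast; ring

lemma coef_pow (u : HomogUnit K) (n : ℕ) : (u ^ n).coef = gammaNat u.deg u.coef n := by
  induction n with
  | zero => rfl
  | succ n ih => rw [pow_succ, coef_mul, ih, deg_pow]; rfl

lemma coef_zpow (u : HomogUnit K) (n : ℤ) : (u ^ n).coef = gamma u.deg u.coef n := by
  cases n with
  | ofNat n => exact (congrArg coef (zpow_natCast u n)).trans (coef_pow u n)
  | negSucc n =>
    rw [zpow_negSucc, coef_inv, deg_pow, coef_pow, ← neg_mul]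
    rfl

@[simp] lemma coef_const_zpow (b : K) (hb : b ≠ 0) (n : ℤ) : (const b hb ^ n).coef = b ^ n := by
  have h : ∀ n : ℕ, (const b hb ^ n).coef = b ^ n := fun n => by
    induction n with
    | zero => simp
    | succ n ih => rw [pow_succ, pow_succ, coef_mul, ih]; simp
  cases n with
  | ofNat n => simpa using h n
  | negSucc n => rw [zpow_negSucc, coef_inv, h]; simp

lemma mul_inv_mem_cone {W : Subring K} {u v : HomogUnit K} :
    v * u⁻¹ ∈ cone W ↔ v.deg = u.deg ∧ v.coef * u.coef⁻¹ ∈ W := by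
  simp only [mem_cone, deg_mul, deg_inv, coef_mul, coef_inv, sg_sg, ← sub_eq_add_neg, sub_eq_zero]
  constructor <;> rintro ⟨h1, h2⟩ <;> refine ⟨h1, ?_⟩ <;> simpa [h1] using h2

lemma assoc_cone_iff {W : Subring K} {u v : HomogUnit K} (huv : u.deg = v.deg) :
    Assoc (cone W) u v ↔ rmulElt (W : Set K) u.coef = rmulElt W v.coef := by
  simp only [Assoc, mul_inv_mem_cone, huv, true_and]
  constructor
  · rintro ⟨h1, h2⟩
    ext x
    rw [mem_rmulElt u.coef_ne, mem_rmulElt v.coef_ne]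
    constructor <;> intro hx
    · have := W.mul_mem hx h1
      simpa [mul_assoc, u.coef_ne] using this
    · have := W.mul_mem hx h2
      simpa [mul_assoc, v.coef_ne] using this
  · intro h
    have h1 : u.coef ∈ rmulElt (W : Set K) u.coef := ⟨1, W.one_mem, by simp⟩
    have h2 : v.coef ∈ rmulElt (W : Set K) v.coef := ⟨1, W.one_mem, by simp⟩
    rw [h, mem_rmulElt v.coef_ne] at h1
    rw [← h, mem_rmulElt u.coef_ne] at h2
    exact ⟨h1, h2⟩

lemma normalizes_cone_iff {W : Subring K} {u : HomogUnit K} :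
    Normalizes (cone W) u ↔ rmulElt (W : Set K) u.coef = lmulElt u.coef (sgSet u.deg W) := by
  have hu := u.coef_ne
  have key : ∀ x : K, x ∈ rmulElt (W : Set K) u.coef ↔ x * u.coef⁻¹ ∈ W := fun x => mem_rmulElt hu
  have key' : ∀ x : K, x ∈ lmulElt u.coef (sgSet u.deg (W : Set K)) ↔
      sg (-u.deg) (u.coef⁻¹ * x) ∈ W := fun x => by rw [mem_lmulElt hu, mem_sgSet]; rfl
  constructor
  · intro h
    ext x
    rw [key, key']
    by_cases hx : x = 0
    · simp [hx, W.zero_mem]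
    have h1 := h ⟨sg (-u.deg) (u.coef⁻¹ * x), 0, by simp [hx, hu]⟩
    simp only [mem_cone, deg_mul, deg_inv, coef_mul, coef_inv, sg_sg, add_neg_cancel, add_zero,
      true_and, zero_sg] at h1
    rwa [mul_inv_cancel_left₀ hu] at h1
  · intro h x
    have h1 : u.coef * sg u.deg x.coef ∈ rmulElt (W : Set K) u.coef ↔
        u.coef * sg u.deg x.coef ∈ lmulElt u.coef (sgSet u.deg (W : Set K)) := by rw [h]
    rw [key, key'] at h1
    simp only [mem_cone, deg_mul, deg_inv, coef_mul, coef_inv, sg_sg]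
    have e : u.deg + x.deg + -u.deg = x.deg := by ring
    rw [e]
    refine and_congr_right fun hx => ?_
    rw [hx, zero_sg]
    simpa [inv_mul_cancel_left₀ hu] using h1

end HomogUnit

end Skew

section DivRing

variable {K : Type*} [DivisionRing K]

lemma mono_mem_gradedSum {G : AddSubgroup ℚ} {A : ℚ → AddSubgroup K} {g : ℚ} (hg : g ∈ G) {a : K} :
    mono g a ∈ gradedSum G A ↔ a ∈ A g := by
  constructor
  · intro h
    simpa [mono] using (h g).1
  · intro h r
    by_cases hr : g = r
    · subst hr
      simpa [mono, hg] using h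
    · simp [mono, hr, (A r).zero_mem]

lemma gradedSum_induction {G : AddSubgroup ℚ} {A : ℚ → AddSubgroup K}
    {p : SkewMonoidAlgebra K (Multiplicative ℚ) → Prop} (h0 : p 0)
    (hadd : ∀ x y, p x → p y → p (x + y)) (hmono : ∀ g ∈ G, ∀ a ∈ A g, p (mono g a))
    {x : SkewMonoidAlgebra K (Multiplicative ℚ)} (hx : x ∈ gradedSum G A) : p x := by
  rw [← SkewMonoidAlgebra.sum_single x, SkewMonoidAlgebra.sum_def']
  refine Finset.sum_induction _ p hadd h0 fun g _ => ?_
  by_cases hg : Multiplicative.toAdd g ∈ G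
  · exact hmono _ hg _ (hx (Multiplicative.toAdd g)).1
  · have := (hx (Multiplicative.toAdd g)).2 hg
    rw [ofAdd_toAdd] at this
    rw [this, SkewMonoidAlgebra.single_zero]
    exact h0

lemma IsTotalValuationRing.mono {V W : Subring K} (hV : IsTotalValuationRing V) (h : V ≤ W) :
    IsTotalValuationRing W := fun x hx => (hV x hx).imp (fun h1 => h h1) fun h1 => h h1

lemma le_of_eq_iUnion_leftOrder {V W : Subring K} {A : ℚ → AddSubgroup K}
    (hA0 : A 0 = V.toAddSubgroup) (hW : (W : Set K) = ⋃ r, (leftOrder (A r) : Set K)) :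
    V ≤ W := fun x hx => by
  have : x ∈ (W : Set K) := by
    rw [hW, Set.mem_iUnion]
    exact ⟨0, by rw [hA0, le_leftOrder_toAddSubgroup]; exact hx⟩
  exact this

/-- `W x` as an additive subgroup. -/
def rmulSubgroup (W : Subring K) (x : K) : AddSubgroup K where
  carrier := rmulElt W x
  zero_mem' := ⟨0, W.zero_mem, by simp⟩
  add_mem' := by
    rintro _ _ ⟨s, hs, rfl⟩ ⟨t, ht, rfl⟩
    exact ⟨s + t, W.add_mem hs ht, by rw [add_mul]⟩
  neg_mem' := by
    rintro _ ⟨s, hs, rfl⟩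
    exact ⟨-s, W.neg_mem hs, by rw [neg_mul]⟩

lemma mul_mem_prodSet {S T : Set K} {x y : K} (hx : x ∈ S) (hy : y ∈ T) : x * y ∈ prodSet S T :=
  AddSubgroup.subset_closure (Set.mul_mem_mul hx hy)

lemma prodSet_subset {S T : Set K} {I : AddSubgroup K} (h : ∀ x ∈ S, ∀ y ∈ T, x * y ∈ I) :
    prodSet S T ⊆ I := (AddSubgroup.closure_le I).2 (by
  rintro _ ⟨x, hx, y, hy, rfl⟩; exact h x hx y hy)

end DivRing

section Skew

variable {K : Type*} [DivisionRing K] [MulSemiringAction (Multiplicative ℚ) K]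

open HomogUnit

/-! ### Graded extensions in terms of homogeneous units -/

lemma mono_mul_mono (r s : ℚ) (x y : K) : mono r x * mono s y = mono (r + s) (x * sg r y) := by
  simp [mono, SkewMonoidAlgebra.single_mul_single, sg]

lemma eq_of_mul_mono_eq_one {g : ℚ} {a : K} (ha : a ≠ 0)
    {y : SkewMonoidAlgebra K (Multiplicative ℚ)} (hy : mono g a * y = 1) :
    y = mono (-g) (sg (-g) a⁻¹) := by
  have h1 : mono (-g) (sg (-g) a⁻¹) * mono g a = 1 := by
    rw [mono_mul_mono]
    have : sg (-g) a ≠ 0 := by simpa using ha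
    simp [this, mono]
  calc y = mono (-g) (sg (-g) a⁻¹) * mono g a * y := by rw [h1, one_mul]
    _ = _ := by rw [mul_assoc, hy, mul_one]

lemma mono_mul_inv {g : ℚ} {a : K} (ha : a ≠ 0) :
    mono (-g) (sg (-g) a⁻¹) * mono g a = 1 ∧ mono g a * mono (-g) (sg (-g) a⁻¹) = 1 := by
  have : sg (-g) a ≠ 0 := by simpa using ha
  constructor
  · rw [mono_mul_mono]
    simp [this, mono]
  · rw [mono_mul_mono]
    simp [ha, mono]

/-- All conditions can be tested on homogeneous units, because the inverse of a homogeneous unit is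
unique and again homogeneous. This moves the problem from the skew group ring into the group
`HomogUnit K`. -/
lemma isGradedExtension_iff {G : AddSubgroup ℚ} {V : Subring K} {A : ℚ → AddSubgroup K} :
    IsGradedExtension G V A ↔
      (∀ u ∈ homogSet A, ∀ v ∈ homogSet A, u.deg ∈ G → v.deg ∈ G → u * v ∈ homogSet A) ∧
      (∀ u : HomogUnit K, u.deg ∈ G → u ∈ homogSet A ∨ u⁻¹ ∈ homogSet A) ∧
      A 0 = V.toAddSubgroup := by
  constructor
  · rintro ⟨⟨S, hS⟩, hinv, h0⟩
    have hS' : ∀ x, x ∈ S ↔ x ∈ gradedSum G A := fun x => Set.ext_iff.1 hS x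
    refine ⟨fun u hu v hv hug hvg => ?_, fun u hug => ?_, h0⟩
    · have h1 := (hS' _).2 ((mono_mem_gradedSum hug).2 hu)
      have h2 := (hS' _).2 ((mono_mem_gradedSum hvg).2 hv)
      have h3 := S.mul_mem h1 h2
      rwa [hS', mono_mul_mono, mono_mem_gradedSum (G.add_mem hug hvg)] at h3
    · rcases hinv u.deg hug u.coef u.coef_ne with h | ⟨y, hy, -, hy1⟩
      · exact .inl ((mono_mem_gradedSum hug).1 h)
      · right
        rw [eq_of_mul_mono_eq_one u.coef_ne hy1, mono_mem_gradedSum (G.neg_mem hug)] at hy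
        exact hy
  · rintro ⟨hmul, hinv, h0⟩
    refine ⟨⟨{ gradedSum G A with
        one_mem' := ?_
        mul_mem' := ?_ }, rfl⟩, fun g hg a ha => ?_, h0⟩
    · rintro x y hx hy
      refine gradedSum_induction (p := fun x => x * y ∈ gradedSum G A) ?_ ?_ ?_ hx
      · simp [(gradedSum G A).zero_mem]
      · intro x x' h1 h2
        rw [add_mul]; exact (gradedSum G A).add_mem h1 h2
      · intro g hg a ha
        refine gradedSum_induction (p := fun y => mono g a * y ∈ gradedSum G A) ?_ ?_ ?_ hy
        · simp [(gradedSum G A).zero_mem]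
        · intro x x' h1 h2
          rw [mul_add]; exact (gradedSum G A).add_mem h1 h2
        · intro g' hg' a' ha'
          rw [mono_mul_mono, mono_mem_gradedSum (G.add_mem hg hg')]
          by_cases ha0 : a = 0
          · simp [ha0, (A (g + g')).zero_mem]
          by_cases ha'0 : a' = 0
          · simp [ha'0, (A (g + g')).zero_mem]
          exact hmul ⟨a, g, ha0⟩ ha ⟨a', g', ha'0⟩ ha' hg hg'
    · have : (1 : SkewMonoidAlgebra K (Multiplicative ℚ)) = mono 0 1 := rfl
      show 1 ∈ gradedSum G A
      rw [this, mono_mem_gradedSum G.zero_mem, h0]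
      exact V.one_mem
    · rcases hinv ⟨a, g, ha⟩ hg with h | h
      · exact .inl ((mono_mem_gradedSum hg).2 h)
      · exact .inr ⟨_, (mono_mem_gradedSum (G.neg_mem hg)).2 h, mono_mul_inv ha⟩

lemma IsGradedExtension.mono_subgroup {G : AddSubgroup ℚ} {V : Subring K} {A : ℚ → AddSubgroup K}
    (h : IsGradedExtension ⊤ V A) : IsGradedExtension G V A := by
  rw [isGradedExtension_iff] at h ⊢
  exact ⟨fun u hu v hv _ _ => h.1 u hu v hv trivial trivial, fun u _ => h.2.1 u trivial, h.2.2⟩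

lemma valCone {W : Subring K} (hW : IsTotalValuationRing W) {b : K} (hb : b ≠ 0)
    (hJ : jac W = rmulElt W b⁻¹) : ValCone degHom (cone W) (const b hb) where
  ker hx := degHom_eq_one_iff.2 hx.1
  one := ⟨rfl, W.one_mem⟩
  mul {x y} hx hy := ⟨by simp [hx.1, hy.1], by
    rw [coef_mul, hx.1, zero_sg]; exact W.mul_mem hx.2 hy.2⟩
  total {x} hx := by
    rw [degHom_eq_one_iff] at hx
    refine (hW x.coef x.coef_ne).imp (fun h => ⟨hx, h⟩) fun h => ⟨by simp [hx], ?_⟩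
    simpa [hx] using h
  gen {x} := by
    simp only [mem_cone, deg_mul, deg_const, add_zero, coef_mul, coef_const, deg_inv, neg_eq_zero,
      coef_inv]
    constructor
    · rintro ⟨h1, h2⟩
      rw [h1, zero_sg] at h2
      have h3 : x.coef ∈ jac W := by rw [hJ, mem_rmulElt (inv_ne_zero hb), inv_inv]; exact h2
      rw [mem_jac hW] at h3
      refine ⟨⟨h1, h3.1⟩, fun h => ?_⟩
      rw [h1, neg_zero, zero_sg] at h
      exact h3.2.resolve_left x.coef_ne h.2
    · rintro ⟨⟨h1, h2⟩, h3⟩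
      refine ⟨h1, ?_⟩
      rw [h1, zero_sg]
      rw [h1, neg_zero, zero_sg] at h3
      have h4 : x.coef ∈ jac W := (mem_jac hW).2 ⟨h2, .inr fun h => h3 ⟨rfl, h⟩⟩
      rwa [hJ, mem_rmulElt (inv_ne_zero hb), inv_inv] at h4

lemma mem_leftOrder_of_forall {A : ℚ → AddSubgroup K} {r : ℚ} {x : HomogUnit K} (hx : x.deg = 0)
    (h : ∀ y ∈ homogSet A, y.deg = r → x * y ∈ homogSet A) : x.coef ∈ leftOrder (A r) := by
  intro y hy
  by_cases hy0 : y = 0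
  · simp [hy0, (A r).zero_mem]
  have := h ⟨y, r, hy0⟩ hy rfl
  simpa [mem_homogSet, hx] using this

lemma gradedCone {V W : Subring K} (hV : IsTotalValuationRing V) {A : ℚ → AddSubgroup K}
    (hA : IsGradedExtension ⊤ V A) (hW : (W : Set K) = ⋃ r, (leftOrder (A r) : Set K))
    {b : K} (hb : b ≠ 0) (hJ : jac W = rmulElt W b⁻¹) (ht : ∃ t : ℚ, leftOrder (A t) = W) :
    GradedCone degHom (homogSet A) (cone W) (const b hb) where
  toValCone := valCone (hV.mono (le_of_eq_iUnion_leftOrder hA.2.2 hW)) hb hJ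
  mul_mem {x y} hx hy := (isGradedExtension_iff.1 hA).1 x hx y hy trivial trivial
  total_mem x := (isGradedExtension_iff.1 hA).2.1 x trivial
  leftOrder_mem {x} d hx h := by
    rw [degHom_eq_one_iff] at hx
    refine ⟨hx, ?_⟩
    have h1 := mem_leftOrder_of_forall (A := A) (r := d.toAdd) hx fun y hy hyd => h y hy hyd
    have h2 : x.coef ∈ (W : Set K) := by
      rw [hW, Set.mem_iUnion]; exact ⟨_, h1⟩
    exact h2
  exists_leftOrder := by
    obtain ⟨t, ht⟩ := ht
    refine ⟨Multiplicative.ofAdd t, fun x hx y hy hyt => ?_⟩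
    have hyt' : y.deg = t := hyt
    have h1 : x.coef ∈ leftOrder (A t) := by rw [ht]; exact hx.2
    rw [mem_homogSet, deg_mul, coef_mul, hx.1, zero_sg, zero_add, hyt']
    exact h1 _ (by rw [← hyt']; exact hy)

/-! ### Products of homogeneous parts -/

lemma prodSet_eq_rmulElt {W : Subring K} {A : ℚ → AddSubgroup K} {u : HomogUnit K}
    (hu : IsTop degHom (homogSet A) (cone W) u) :
    prodSet W (A u.deg) = rmulElt W u.coef := by
  refine Set.Subset.antisymm (prodSet_subset (I := rmulSubgroup W u.coef) fun w hw x hx => ?_) ?_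
  · by_cases hx0 : x = 0
    · simp [hx0, (rmulSubgroup W u.coef).zero_mem]
    have h1 := hu.2 ⟨x, u.deg, hx0⟩ hx rfl
    rw [mul_inv_mem_cone] at h1
    exact (mem_rmulElt u.coef_ne).2 (by simpa [mul_assoc] using W.mul_mem hw h1.2)
  · rintro _ ⟨w, hw, rfl⟩
    exact mul_mem_prodSet hw hu.1

lemma coe_eq_rmulElt {W : Subring K} {A : ℚ → AddSubgroup K} {u : HomogUnit K}
    (hu : IsTop degHom (homogSet A) (cone W) u)
    (h : ∀ p ∈ cone W, p * u ∈ homogSet A) : (A u.deg : Set K) = rmulElt W u.coef := by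
  refine Set.Subset.antisymm ?_ ?_
  · rw [← prodSet_eq_rmulElt hu]
    intro x hx
    simpa using mul_mem_prodSet W.one_mem hx
  · rintro _ ⟨w, hw, rfl⟩
    by_cases hw0 : w = 0
    · simp [hw0, (A u.deg).zero_mem]
    have := h ⟨w, 0, hw0⟩ ⟨rfl, hw⟩
    simpa [mem_homogSet] using this

lemma prodSet_rmulElt {W : Subring K} {u : HomogUnit K} (hu : Normalizes (cone W) u) (y : K) :
    prodSet (rmulElt W u.coef) (sgSet u.deg (rmulElt W y)) =
      rmulElt W (u.coef * sg u.deg y) := by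
  refine Set.Subset.antisymm
    (prodSet_subset (I := rmulSubgroup W (u.coef * sg u.deg y)) ?_) ?_
  · rintro _ ⟨w, hw, rfl⟩ _ ⟨_, ⟨w', hw', rfl⟩, rfl⟩
    rw [normalizes_cone_iff] at hu
    have h1 : u.coef * sg u.deg w' ∈ lmulElt u.coef (sgSet u.deg (W : Set K)) :=
      ⟨_, ⟨w', hw', rfl⟩, rfl⟩
    rw [← hu] at h1
    obtain ⟨w'', hw'', h2⟩ := h1
    refine ⟨w * w'', W.mul_mem hw hw'', ?_⟩
    rw [sg_mul, ← mul_assoc, mul_assoc w, h2]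
    simp only [mul_assoc]
  · rintro _ ⟨w, hw, rfl⟩
    rw [← mul_assoc]
    exact mul_mem_prodSet ⟨w, hw, rfl⟩ ⟨y, ⟨1, W.one_mem, by simp⟩, rfl⟩

end Skew

/-! ### Systems of generators -/

section Tops

variable {G : Type*} [Group G]

/-- `β r` generates, over `P`, the part of `S` of degree `r`, and `ε` records the failure of `β` to
be multiplicative up to units of `P`. -/
structure IsTopSystem (π : G →* Multiplicative ℚ) (S P : Set G) (b : G) (β : ℚ → G)
    (ε : ℚ → ℚ → ℤ) : Prop extends GradedCone π S P b, IsExtCocycle ε where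
  map_zero : β 0 = 1
  map_deg : ∀ r, π (β r) = Multiplicative.ofAdd r
  isTop : ∀ r, IsTop π S P (β r)
  assoc_mul' : ∀ r s, Assoc P (β r * β s) (b ^ (-ε r s) * β (r + s))

lemma GradedCone.exists_isTopSystem {π : G →* Multiplicative ℚ} {S P : Set G} {b : G}
    (h : GradedCone π S P b) : ∃ β ε, IsTopSystem π S P b β ε := by
  classical
  choose u hu1 hu using fun r : ℚ => h.exists_isTop (Multiplicative.ofAdd r)
  obtain ⟨β, hβ⟩ : ∃ β : ℚ → G, β = fun r => if r = 0 then 1 else u r := ⟨_, rfl⟩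
  have hβ0 : β 0 = 1 := by simp [hβ]
  have hβ1 : ∀ r, π (β r) = Multiplicative.ofAdd r := fun r => by
    by_cases hr : r = 0
    · rw [hr, hβ0, map_one]; rfl
    · simp [hβ, hr, hu1]
  have hβt : ∀ r, IsTop π S P (β r) := fun r => by
    by_cases hr : r = 0
    · rw [hr, hβ0]; exact h.isTop_one
    · simp [hβ, hr, hu]
  have hβn : ∀ r, Normalizes P (β r) := fun r => h.normalizes (hβt r)
  have hex : ∀ r s, ∃ e : ℤ, (0 ≤ e ∧ e ≤ 1) ∧ Assoc P (β r * β s) (b ^ (-e) * β (r + s)) := by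
    intro r s
    rcases h.assoc_mul_top (hβt r) (hβt s) (hβt (r + s)) (by simp [hβ1]) with h1 | h1
    · exact ⟨0, by norm_num, by simpa using h1⟩
    · exact ⟨1, by norm_num, by simpa using h1⟩
  choose ε hε01 hε using hex
  have hzero : ∀ r s, Assoc P (β r * β s) (β (r + s)) → ε r s = 0 := fun r s h1 => by
    have h2 := h.assoc_trans h1.symm (hε r s)
    have h3 : Assoc P (b ^ (0 : ℤ) * β (r + s)) (b ^ (-ε r s) * β (r + s)) := by simpa using h2
    have := h.assoc_gen_zpow_iff.1 h3
    omega
  refine ⟨β, ε, h, ⟨fun r => hzero _ _ ?_, fun r => hzero _ _ ?_, fun r s => (hε01 r s).1,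
    fun r => (hε01 _ _).2, fun r s u => ?_⟩, hβ0, hβ1, hβt, hε⟩
  · simpa [hβ0] using h.assoc_refl (β r)
  · simpa [hβ0] using h.assoc_refl (β r)
  -- The two bracketings of `β r * β s * β u` are compared; the second requires moving a power of
  -- `b` past `β r`.
  · have h1 := (hε r s).mul_right (β u)
    have h2 := (hε (r + s) u).mul_left (h.gen_normalizes.zpow (-ε r s))
    have h3 := (hε s u).mul_left (hβn r)
    have h4 := (h.assoc_gen_zpow_comm (hβn r) (-ε s u)).mul_right (β (s + u))
    have h5 := (hε r (s + u)).mul_left (h.gen_normalizes.zpow (-ε s u))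
    simp only [mul_assoc, add_assoc] at h1 h2 h3 h4 h5
    have h6 := h.assoc_trans (h.assoc_trans h1 h2).symm
      (h.assoc_trans (h.assoc_trans h3 h4) h5)
    simp only [← mul_assoc, ← zpow_add] at h6
    have h7 := h.assoc_gen_zpow_iff.1 h6
    linarith

namespace IsTopSystem

variable {π : G →* Multiplicative ℚ} {S P : Set G} {b : G} {β : ℚ → G} {ε : ℚ → ℚ → ℤ}

lemma normalizes_top (h : IsTopSystem π S P b β ε) (r : ℚ) : Normalizes P (β r) :=
  h.toGradedCone.normalizes (h.isTop r)

lemma map_neg (h : IsTopSystem π S P b β ε) (r : ℚ) : π (β (-r)) = (π (β r))⁻¹ := by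
  simp [h.map_deg]

lemma mul_neg_gen_mem (h : IsTopSystem π S P b β ε) {r : ℚ} (hr : ε r (-r) = 1) :
    β r * β (-r) * b ∈ P := by
  have := (h.assoc_mul' r (-r)).1
  simpa [hr, h.map_zero] using this

lemma inv_mul_neg_mem (h : IsTopSystem π S P b β ε) {r : ℚ} (hr : ε r (-r) = 0) :
    (β r * β (-r))⁻¹ ∈ P := by
  have := (h.assoc_mul' r (-r)).2
  simpa [hr, h.map_zero] using this

lemma neg_eq (h : IsTopSystem π S P b β ε) (r : ℚ) : ε r (-r) = 0 ∨ ε r (-r) = 1 := by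
  have := h.nonneg r (-r)
  have := h.neg_le r
  omega

lemma eq_one_of_nonunit (h : IsTopSystem π S P b β ε) {r : ℚ} (hr : β r * β (-r) * b ∈ P) :
    ε r (-r) = 1 :=
  (h.neg_eq r).resolve_left fun h0 => (h.gen.1 hr).2 (h.inv_mul_neg_mem h0)

/-- This identifies the abstract splitting with the exponent relating the generator in degree `is`
to the `i`-th power of `β s`, as in the definition of the nice map. -/
lemma assoc_step (h : IsTopSystem π S P b β ε) {s : ℚ} {F : ℤ → ℤ} (hF : IsStepSplitting ε s F)
    (i : ℤ) : Assoc P (β (i * s)) (b ^ F i * β s ^ i) := by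
  have step : ∀ i : ℤ, F (i + 1) = F i + ε (i * s) s ∧
      Assoc P (β (i * s) * β s) (b ^ (-ε (i * s) s) * β ((i + 1 : ℤ) * s)) := fun i => by
    refine ⟨by simpa [hF.1] using hF.2 i 1, ?_⟩
    have := h.assoc_mul' (i * s) s
    have e : (i : ℚ) * s + s = (i + 1 : ℤ) * s := by push_cast; ring
    rwa [e] at this
  induction i with
  | zero => simpa [hF.map_zero h.toIsExtCocycle, h.map_zero] using h.assoc_refl 1
  | succ i ih =>
    obtain ⟨h1, h2⟩ := step i
    have h3 := (h2.symm.mul_left (h.gen_normalizes.zpow (ε ((i : ℤ) * s) s)))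
    have h4 := (ih.mul_right (β s)).mul_left (h.gen_normalizes.zpow (ε ((i : ℤ) * s) s))
    have h5 := h.assoc_trans h3 h4
    rw [← mul_assoc, ← zpow_add, add_neg_cancel, zpow_zero, one_mul, mul_assoc, ← zpow_add_one,
      ← mul_assoc, ← zpow_add, add_comm _ (F i), ← h1] at h5
    exact h5
  | pred i ih =>
    obtain ⟨h1, h2⟩ := step (-(i : ℤ) - 1)
    rw [sub_add_cancel] at h1 h2
    have h3 := h2.mul_right (β s)⁻¹
    have h4 := (ih.mul_right (β s)⁻¹).mul_left
      (h.gen_normalizes.zpow (-ε ((-(i : ℤ) - 1 : ℤ) * s) s))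
    rw [mul_assoc] at h3
    simp only [mul_inv_cancel, mul_one] at h3
    simp only [mul_assoc] at h3 h4
    have h5 := h.assoc_trans h3 h4
    rw [← zpow_sub_one, ← mul_assoc, ← zpow_add, h1] at h5
    simpa using h5

/-- A splitting of the cocycle makes the system of generators multiplicative. -/
lemma assoc_mul_of_splitting (h : IsTopSystem π S P b β ε) {f : ℚ → ℤ}
    (hf : ∀ r s, f (r + s) = f r + f s + ε r s) (r s : ℚ) :
    Assoc P (b ^ (-f r) * β r * (b ^ (-f s) * β s)) (b ^ (-f (r + s)) * β (r + s)) := by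
  have h1 := ((h.assoc_gen_zpow_comm (h.normalizes_top r) (-f s)).mul_right (β s)).mul_left
    (h.gen_normalizes.zpow (-f r))
  have h2 := (h.assoc_mul' r s).mul_left ((h.gen_normalizes.zpow (-f r)).mul
    (h.gen_normalizes.zpow (-f s)))
  simp only [mul_assoc] at h1 h2 ⊢
  have h3 := h.assoc_trans h1 h2
  simp only [← mul_assoc, ← zpow_add] at h3 ⊢
  have e : -f r + (-f s + -ε r s) = -f (r + s) := by rw [hf]; ring
  rwa [e] at h3

lemma isGradedMap_of_splitting (h : IsTopSystem π S P b β ε) {f : ℚ → ℤ}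
    (hf : ∀ r s, f (r + s) = f r + f s + ε r s) : IsGradedMap f := by
  have h0 : f 0 = 0 := by
    have := hf 0 0
    rw [add_zero, h.zero_left] at this
    omega
  refine ⟨h0, fun r s => ?_, fun r => ?_⟩
  · have := hf r s
    have := h.nonneg r s
    omega
  · have h1 := hf r (-r)
    have := h.neg_le r
    rw [add_neg_cancel, h0] at h1
    omega

end IsTopSystem

end Tops

section DivRing

variable {K : Type*} [DivisionRing K]

lemma leftOrder_eq_of_coe_eq {W : Subring K} {I : AddSubgroup K} {x : K} (hx : x ≠ 0)
    (hI : (I : Set K) = rmulElt W x) : leftOrder I = W := by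
  have hmem : ∀ y, y ∈ I ↔ y * x⁻¹ ∈ W := fun y => by
    rw [← SetLike.mem_coe, hI, mem_rmulElt hx]; rfl
  ext a
  rw [mem_leftOrder]
  constructor
  · intro h
    have := h x ((hmem x).2 (by simp [hx, W.one_mem]))
    simpa [hmem, mul_assoc, hx] using this
  · intro ha y hy
    rw [hmem] at hy ⊢
    rw [mul_assoc]
    exact W.mul_mem ha hy

end DivRing

/-! ### The generators and cocycle of a graded extension of `V` -/

section Skew

variable {K : Type*} [DivisionRing K] [MulSemiringAction (Multiplicative ℚ) K]

open HomogUnit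

/-- The standing data: a graded extension `A` of `V` with its ring `W`, the generator `b⁻¹` of
`J(W)`, and a system of generators. -/
structure ExtData (V W : Subring K) (A : ℚ → AddSubgroup K) (b : K) (hb : b ≠ 0)
    (β : ℚ → HomogUnit K) (ε : ℚ → ℚ → ℤ) : Prop
    extends IsTopSystem degHom (homogSet A) (cone W) (const b hb) β ε where
  isTotal : IsTotalValuationRing W
  isGradedExtension : IsGradedExtension ⊤ V A
  jac_eq : jac W = rmulElt W b⁻¹

namespace ExtData

variable {V W : Subring K} {A : ℚ → AddSubgroup K} {b : K} {hb : b ≠ 0} {β : ℚ → HomogUnit K}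
  {ε : ℚ → ℚ → ℤ}

lemma deg_top (h : ExtData V W A b hb β ε) (r : ℚ) : (β r).deg = r := h.map_deg r

lemma prodSet_eq (h : ExtData V W A b hb β ε) (r : ℚ) :
    prodSet W (A r) = rmulElt W (β r).coef := by
  have := prodSet_eq_rmulElt (h.isTop r)
  rwa [h.deg_top] at this

lemma coe_eq (h : ExtData V W A b hb β ε) {r : ℚ} (hr : ∀ p ∈ cone W, p * β r ∈ homogSet A) :
    (A r : Set K) = rmulElt W (β r).coef := by
  have := coe_eq_rmulElt (h.isTop r) hr
  rwa [h.deg_top] at this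

lemma rmulElt_eq_lmulElt (h : ExtData V W A b hb β ε) (r : ℚ) :
    rmulElt (W : Set K) (β r).coef = lmulElt (β r).coef (sgSet r W) := by
  have := normalizes_cone_iff.1 (h.normalizes_top r)
  rwa [h.deg_top] at this

lemma coe_eq_of_nonunit (h : ExtData V W A b hb β ε) {r : ℚ} (hr : ε r (-r) = 1) :
    (A r : Set K) = rmulElt W (β r).coef :=
  h.coe_eq fun _ hp => h.mul_mem_of_nonunit (h.isTop r) (h.isTop (-r)) (h.map_neg r)
    (h.mul_neg_gen_mem hr) hp

lemma exists_notMem_of_ne (h : ExtData V W A b hb β ε) (hVW : W ≠ V) :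
    ∃ x₀ ∈ cone W, x₀ ∉ homogSet A := by
  by_contra hcon
  push Not at hcon
  have hA0 := h.isGradedExtension.2.2
  refine hVW (le_antisymm (fun x hx => ?_) fun x hx => ?_)
  · by_cases hx0 : x = 0
    · simp [hx0, V.zero_mem]
    have := hcon ⟨x, 0, hx0⟩ ⟨rfl, hx⟩
    rw [mem_homogSet, hA0] at this
    exact this
  · by_cases hx0 : x = 0
    · simp [hx0, W.zero_mem]
    have h1 : (⟨x, 0, hx0⟩ : HomogUnit K) ∈ homogSet A := by
      rw [mem_homogSet, hA0]; exact hx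
    exact (h.sub h1 rfl).2

lemma coe_eq_of_eq (h : ExtData V W A b hb β ε) (hVW : W = V) (r : ℚ) :
    (A r : Set K) = rmulElt W (β r).coef :=
  h.coe_eq fun p hp => h.mul_mem (by
    rw [mem_homogSet, hp.1, h.isGradedExtension.2.2, ← hVW]; exact hp.2) (h.isTop r).1

lemma exists_eq_one_of_ne (h : ExtData V W A b hb β ε) (hVW : W ≠ V) : ∃ t, ε t (-t) = 1 := by
  obtain ⟨x₀, h1, h2⟩ := h.exists_notMem_of_ne hVW
  obtain ⟨t, ht⟩ := h.exists_nonunit_degree h1 h2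
  exact ⟨t.toAdd, h.eq_one_of_nonunit (ht _ _ (h.isTop _) (h.isTop _) (h.map_deg _)
    (h.map_deg _))⟩

lemma prodSet_sgSet (h : ExtData V W A b hb β ε) (r : ℚ) (y : K) :
    prodSet (rmulElt W (β r).coef) (sgSet r (rmulElt W y)) =
      rmulElt W ((β r).coef * sg r y) := by
  have := prodSet_rmulElt (h.normalizes_top r) y
  rwa [h.deg_top] at this

/-- Otherwise `ε` vanishes identically and `W = V`, so `A_r A_s^{σ(r)} = A_{r+s}` in all degrees,
contradicting Type (II). -/
lemma exists_eq_one (h : ExtData V W A b hb β ε) (hE : IsTypeE V A) : ∃ t, ε t (-t) = 1 := by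
  by_contra hcon
  push Not at hcon
  have h0 : ∀ r, ε r (-r) = 0 := fun r => (h.neg_eq r).resolve_right (hcon r)
  have hVW : W = V := by
    by_contra hVW
    obtain ⟨t, ht⟩ := h.exists_eq_one_of_ne hVW
    exact hcon t ht
  have hA := h.coe_eq_of_eq hVW
  have hprod : ∀ r s, prodSet (A r) (sgSet r (A s)) = (A (r + s) : Set K) := fun r s => by
    rw [hA, hA, hA, h.prodSet_sgSet]
    have h1 := h.assoc_mul' r s
    rw [h.eq_zero_of_neg (h0 s), neg_zero, zpow_zero, one_mul,
      assoc_cone_iff (by simp [h.deg_top])] at h1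
    rw [← h1, coef_mul, h.deg_top]
  obtain ⟨-, r, -, ⟨-, g, -, k, -, -, -, hgk⟩, -⟩ := hE
  rcases hgk with hgk | hgk
  · exact hgk (hprod g k)
  · exact hgk (by rw [hprod, sub_eq_add_neg])

lemma coe_neg_eq_of_nonunit (h : ExtData V W A b hb β ε) {r : ℚ} (hr : ε r (-r) = 1) :
    (A (-r) : Set K) = rmulElt (jac W) (sg (-r) (β r).coef⁻¹) := by
  have hd := h.deg_top r
  have hne : sg (-r) (β r).coef⁻¹ ≠ 0 := by simpa using (β r).coef_ne
  have key : ∀ x : HomogUnit K, x.deg = -r →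
      (x ∈ homogSet A ↔ x * β r * const b hb ∈ cone W) := by
    intro x hx
    have hn := h.normalizes_top r
    have hc : β r * x * const b hb ∈ cone W ↔ x * β r * const b hb ∈ cone W := by
      rw [h.gen, h.gen, ← hn (x * β r), ← hn (x * β r)⁻¹]
      simp [mul_assoc]
    constructor
    · intro hxS
      rw [← hc]
      exact h.inv_degree_nonunit_of_nonunit (h.isTop r) (h.isTop (-r)) (h.map_neg r)
        (h.mul_neg_gen_mem hr) hxS (by
          rw [h.map_deg]
          show Multiplicative.ofAdd x.deg = _
          rw [hx]; rfl)
    · intro hxP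
      have := h.inv_mul_nonunit_mem (h.isTop r) (hc.2 hxP)
      simpa using this
  have h0 : (0 : K) ∈ jac W := (mem_jac h.isTotal).2 ⟨W.zero_mem, .inl rfl⟩
  ext x
  rw [mem_rmulElt hne]
  by_cases hx0 : x = 0
  · simp [hx0, (A (-r)).zero_mem, h0]
  have h1 := key ⟨x, -r, hx0⟩ rfl
  rw [mem_homogSet, mem_cone] at h1
  simp only [deg_mul, hd, deg_const, coef_mul, coef_const] at h1
  rw [SetLike.mem_coe, h1, h.jac_eq, mem_rmulElt (inv_ne_zero hb)]
  simp

lemma isAdmissible (h : ExtData V W A b hb β ε) {l : ℕ} (hl : 0 < l)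
    (h1 : ε (1 / l) (-(1 / l)) = 1) : IsAdmissible V W A l := by
  have hA := h.coe_eq_of_nonunit h1
  have hL := leftOrder_eq_of_coe_eq (β (1 / l)).coef_ne hA
  refine ⟨hl, ⟨h.isGradedExtension.mono_subgroup, (β (1 / l)).coef, ?_⟩, hL⟩
  rw [hL]
  exact ⟨hA, hA.trans (h.rmulElt_eq_lmulElt _), h.coe_neg_eq_of_nonunit h1, b, hb, h.jac_eq⟩

lemma isStepMap (h : ExtData V W A b hb β ε) {s : ℚ} (hs : ε s (-s) = 1) {F : ℤ → ℤ}
    (hF : IsStepSplitting ε s F) : IsStepMap W b A s F := by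
  refine ⟨⟨hF.isGradedMap h.toIsExtCocycle, hF.1, ?_⟩, (β s).coef, h.prodSet_eq s,
    h.rmulElt_eq_lmulElt s, fun i => ?_⟩
  · rw [hF.map_neg_one h.toIsExtCocycle, hs]
  · have h1 := h.assoc_step hF i
    rw [assoc_cone_iff (by simp [h.deg_top])] at h1
    rw [h.prodSet_eq, h1, coef_mul, deg_zpow, deg_const, mul_zero, zero_sg, coef_const_zpow,
      coef_zpow, h.deg_top]

end ExtData

end Skew

/-! ### Splitting the cocycle and obtaining the classification -/

section Skew

variable {K : Type*} [DivisionRing K] [MulSemiringAction (Multiplicative ℚ) K]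

open HomogUnit

lemma exists_int_bound_of_sSup_lt_top {s : Set EReal} (h : sSup s < ⊤) :
    ∃ C : ℤ, ∀ z : ℤ, ((z : ℝ) : EReal) ∈ s → z ≤ C := by
  obtain ⟨x, hx, -⟩ := EReal.lt_iff_exists_real_btwn.1 h
  refine ⟨⌊x⌋, fun z hz => Int.le_floor.2 ?_⟩
  exact_mod_cast ((le_sSup hz).trans_lt hx).le

namespace ExtData

variable {V W : Subring K} {A : ℚ → AddSubgroup K} {b : K} {hb : b ≠ 0} {β : ℚ → HomogUnit K}
  {ε : ℚ → ℚ → ℤ}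

/-- The degrees with `ε(s,-s) = 0` form a subgroup, so the value 1 passes to divisors. One degree
`t` therefore makes `t.den` admissible and all finer steps nice. -/
lemma eq_one_of_int_mul (h : ExtData V W A b hb β ε) {t s : ℚ} (ht : ε t (-t) = 1) (i : ℤ)
    (hts : t = i * s) : ε s (-s) = 1 := by
  refine (h.neg_eq s).resolve_left fun h0 => ?_
  have h1 := h.toIsExtCocycle.kernel.zsmul_mem (h.mem_kernel.2 h0) i
  rw [zsmul_eq_mul, ← hts, h.mem_kernel, ht] at h1
  exact one_ne_zero h1

lemma eq_one_inv_mul (h : ExtData V W A b hb β ε) {t : ℚ} (ht : ε t (-t) = 1) {n : ℕ} (hn : 0 < n) :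
    ε (1 / ((n : ℚ) * t.den)) (-(1 / ((n : ℚ) * t.den))) = 1 := by
  refine h.eq_one_of_int_mul ht (n * t.num) ?_
  have := t.den_pos.ne'
  conv_lhs => rw [← Rat.num_div_den t]
  push_cast
  field_simp

/-- The cocycle splits if `l_m` or `k_m` is finite for some `m`. -/
lemma exists_splitting (h : ExtData V W A b hb β ε) {t : ℚ} (ht : ε t (-t) = 1) {m : ℚ}
    (hm : 0 < m) (hfin : lSup V W b A m < ⊤ ∨ kSup V W b A m < ⊤) :
    ∃ f : ℚ → ℤ, ∀ r s, f (r + s) = f r + f s + ε r s := by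
  have hadm : IsAdmissible V W A t.den :=
    h.isAdmissible t.den_pos (by simpa using h.eq_one_inv_mul ht one_pos)
  obtain ⟨p, hp⟩ : ∃ p : ℕ, m.num = p := ⟨m.num.toNat, by
    have := Rat.num_pos.2 hm; omega⟩
  have hp0 : 0 < p := by
    have := Rat.num_pos.2 hm; omega
  have hq : 0 < t.den * m.den := Nat.mul_pos t.den_pos m.den_pos
  have hpos : 0 < p * t.den := Nat.mul_pos hp0 t.den_pos
  have hone : ∀ n : ℕ, 0 < n → ε (1 / ((n : ℚ) * ((t.den : ℚ) * m.den)))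
      (-(1 / ((n : ℚ) * ((t.den : ℚ) * m.den)))) = 1 := fun n hn => by
    have := h.eq_one_inv_mul ht (Nat.mul_pos hn m.den_pos)
    have e : ((n * m.den : ℕ) : ℚ) * t.den = (n : ℚ) * ((t.den : ℚ) * m.den) := by
      push_cast; ring
    rwa [e] at this
  rcases hfin with hfin | hfin
  · obtain ⟨C, hC⟩ := exists_int_bound_of_sSup_lt_top hfin
    refine h.toIsExtCocycle.exists_splitting hq hpos C fun n hn F hF => hC _
      ⟨t.den, n, hadm, hn, F, h.isStepMap (hone n hn) (by push_cast at hF; exact hF), ?_⟩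
    rw [hp]
    push_cast
    rw [mul_assoc]
  -- Steps `-1/(nq)` for `ε` are steps `1/(nq)` for the reversed cocycle, whose splitting is pulled
  -- back along `r ↦ -r`.
  · obtain ⟨C, hC⟩ := exists_int_bound_of_sSup_lt_top hfin
    obtain ⟨f, hf⟩ := h.toIsExtCocycle.reverse.exists_splitting hq hpos C fun n hn F hF => hC _
      ⟨t.den, n, hadm, hn, F, h.isStepMap (by
        rw [neg_neg, h.symm_neg]; exact hone n hn) ⟨hF.1, fun i j => by
          have := hF.2 i j
          push_cast at this
          simpa using this⟩, by
        rw [hp]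
        push_cast
        rw [mul_assoc]⟩
    exact ⟨fun r => f (-r), fun r s => by simpa [add_comm] using hf (-r) (-s)⟩

end ExtData

/-- The conditions of the classification, for given `f` and `α`. -/
def IsClassifiedBy (V W : Subring K) (A : ℚ → AddSubgroup K) (b : K) (f : ℚ → ℤ) (α : ℚ → K) :
    Prop :=
  (IsGradedMap f ∧ f ≠ 0 ∧ α 0 = 1 ∧
    (∀ r, prodSet W (A r) = rmulElt W (b ^ f r * α r)) ∧
    (∀ r, rmulElt (W : Set K) (α r) = lmulElt (α r) (sgSet r W)) ∧
    (∀ r s,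
      prodSet (rmulElt W (α r)) (sgSet r (rmulElt W (α s))) =
          rmulElt W (α r * sg r (α s)) ∧
        rmulElt (W : Set K) (α r * sg r (α s)) = rmulElt W (α (r + s)))) ∧
  ((W = V ∨ ∀ r, r ≠ 0 → f r + f (-r) = -1) →
    ∀ r, r ≠ 0 → (A r : Set K) = rmulElt W (b ^ f r * α r)) ∧
  ((W ≠ V ∧ ∃ r : ℚ, 0 < r ∧ f r + f (-r) = 0) →
    ∃ k : ℚ, IsLeast {r : ℚ | 0 < r ∧ f r + f (-r) = 0} k ∧
      (∀ r, r ∉ AddSubgroup.zmultiples k → (A r : Set K) = rmulElt W (b ^ f r * α r)) ∧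
      IsGradedExtension (AddSubgroup.zmultiples k) V A ∧
      ∀ j : ℤ,
        rmulElt W (b ^ (f (j * k) - 1) * α (j * k)) ⊂ (A (j * k) : Set K) ∧
        (A (j * k) : Set K) ⊂ rmulElt W (b ^ f (j * k) * α (j * k)))

namespace ExtData

variable {V W : Subring K} {A : ℚ → AddSubgroup K} {b : K} {hb : b ≠ 0} {β : ℚ → HomogUnit K}
  {ε : ℚ → ℚ → ℤ}

/-- The homogeneous parts of degree `r` with `ε(r, -r) = 0` lie strictly between `J(W) β_r` and
`W β_r`. -/
lemma ssubset (h : ExtData V W A b hb β ε) (hVW : W ≠ V) {r : ℚ} (hr : ε r (-r) = 0) :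
    rmulElt (W : Set K) (b⁻¹ * (β r).coef) ⊂ (A r : Set K) ∧
      (A r : Set K) ⊂ rmulElt W (β r).coef := by
  obtain ⟨x₀, hx₀, hx₀S⟩ := h.exists_notMem_of_ne hVW
  have hne := (β r).coef_ne
  have htop : (β r).coef ∈ (A r : Set K) := by
    have := (h.isTop r).1
    rwa [mem_homogSet, h.deg_top] at this
  refine ⟨(Set.ssubset_iff_of_subset ?_).2 ⟨(β r).coef, htop, ?_⟩,
    (Set.ssubset_iff_of_subset ?_).2 ?_⟩
  · rintro _ ⟨w, hw, rfl⟩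
    by_cases hw0 : w = 0
    · simp [hw0, (A r).zero_mem]
    have h1 := h.nonunit_mul_mem (h.isTop r) (x := const w hw0 * (const b hb)⁻¹)
      ⟨by simp, by simpa using hw⟩
    rw [mem_homogSet] at h1
    simpa [h.deg_top, mul_assoc] using h1
  · rw [mem_rmulElt (mul_ne_zero (inv_ne_zero hb) hne), mul_inv_rev, inv_inv, ← mul_assoc,
      mul_inv_cancel₀ hne, one_mul]
    exact fun hbW => h.gen_notMem ⟨rfl, hbW⟩
  · rw [← h.prodSet_eq]
    intro x hx
    simpa using mul_mem_prodSet W.one_mem hx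
  · obtain ⟨p, hp, hpS⟩ := h.exists_mul_notMem hx₀ hx₀S (h.isTop (-r)).1 (h.map_neg r)
      (h.inv_mul_neg_mem hr)
    refine ⟨_, ⟨p.coef, hp.2, rfl⟩, fun hmem => hpS ?_⟩
    rw [mem_homogSet, deg_mul, coef_mul, hp.1, zero_sg, zero_add, h.deg_top]
    exact hmem

lemma isClassifiedBy (h : ExtData V W A b hb β ε) {t : ℚ} (ht : ε t (-t) = 1) {f : ℚ → ℤ}
    (hf : ∀ r s, f (r + s) = f r + f s + ε r s) :
    IsClassifiedBy V W A b f fun r => b ^ (-f r) * (β r).coef := by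
  have hgm := h.isGradedMap_of_splitting hf
  have hne := fun r => mul_ne_zero (zpow_ne_zero (-f r) hb) (β r).coef_ne
  -- the elements `α_r`, as homogeneous units
  obtain ⟨u, hu⟩ : ∃ u : ℚ → HomogUnit K, ∀ r, u r = const b hb ^ (-f r) * β r :=
    ⟨_, fun _ => rfl⟩
  have hucoef : ∀ r, (u r).coef = b ^ (-f r) * (β r).coef := fun r => by simp [hu]
  have hudeg : ∀ r, (u r).deg = r := fun r => by simp [hu, h.deg_top]
  have hun : ∀ r, Normalizes (cone W) (u r) := fun r => by
    rw [hu]; exact (h.gen_normalizes.zpow _).mul (h.normalizes_top r)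
  have hfα : ∀ r, b ^ f r * (b ^ (-f r) * (β r).coef) = (β r).coef := fun r => by
    rw [← mul_assoc, ← zpow_add₀ hb, add_neg_cancel, zpow_zero, one_mul]
  have hfα' : ∀ r, b ^ (f r - 1) * (b ^ (-f r) * (β r).coef) = b⁻¹ * (β r).coef := fun r => by
    rw [← mul_assoc, ← zpow_add₀ hb]
    congr 1
    rw [show f r - 1 + -f r = -1 by ring, zpow_neg_one]
  have hε : ∀ r, f r + f (-r) = -ε r (-r) := fun r => by
    have := hf r (-r)
    rw [add_neg_cancel, hgm.1] at this
    omega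
  refine ⟨⟨hgm, ?_, ?_, ?_, ?_, ?_⟩, ?_, ?_⟩
  · rintro rfl
    have := hε t
    simp [ht] at this
  · simp [hgm.1, h.map_zero]
  · intro r
    simp only [hfα]
    exact h.prodSet_eq r
  · intro r
    have := normalizes_cone_iff.1 (hun r)
    rwa [hucoef, hudeg] at this
  · intro r s
    have h1 := prodSet_rmulElt (hun r) (u s).coef
    have h2 := h.assoc_mul_of_splitting hf r s
    rw [← hu, ← hu, ← hu, assoc_cone_iff (by simp [hudeg])] at h2
    simp only [coef_mul, hucoef, hudeg] at h1 h2
    exact ⟨h1, h2⟩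
  · intro hcase r hr
    simp only [hfα]
    rcases hcase with hVW | hall
    · exact h.coe_eq_of_eq hVW r
    · refine h.coe_eq_of_nonunit ?_
      have := hall r hr
      rw [hε] at this
      omega
  · rintro ⟨hVW, r, hr, hfr⟩
    have hf0 : f ≠ 0 := by
      rintro rfl
      have := hε t
      simp [ht] at this
    obtain ⟨k, hk⟩ := hgm.exists_isLeast hf0 hr hfr
    refine ⟨k, hk, fun r hr => ?_, h.isGradedExtension.mono_subgroup, fun j => ?_⟩
    · simp only [hfα]
      refine h.coe_eq_of_nonunit ?_
      rw [← hgm.add_neg_eq_zero_iff hk, hε] at hr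
      exact (h.neg_eq r).resolve_left fun h0 => hr (by simp [h0])
    · simp only [hfα, hfα']
      refine h.ssubset hVW ?_
      have h1 : (j : ℚ) * k ∈ AddSubgroup.zmultiples k := ⟨j, by simp⟩
      rw [← hgm.add_neg_eq_zero_iff hk, hε] at h1
      omega

end ExtData

end Skew

section Skew

variable {K : Type*} [DivisionRing K] [MulSemiringAction (Multiplicative ℚ) K]

open HomogUnit

/-! ### From the classification to the graded extension -/

namespace IsClassifiedBy

variable {V W : Subring K} {A : ℚ → AddSubgroup K} {b : K} {f : ℚ → ℤ} {α : ℚ → K}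

lemma ne_zero (h : IsClassifiedBy V W A b f α) (r : ℚ) : α r ≠ 0 := by
  intro h0
  have h1 := (h.1.2.2.2.2.2 r (-r)).2
  rw [h0, zero_mul, add_neg_cancel, h.1.2.2.1] at h1
  have h2 : (1 : K) ∈ rmulElt (W : Set K) 1 := ⟨1, W.one_mem, by simp⟩
  rw [← h1] at h2
  obtain ⟨w, -, hw⟩ := h2
  simp at hw

/-- `b^{f(r)} α_r X^r` -/
def unit (h : IsClassifiedBy V W A b f α) (hb : b ≠ 0) (r : ℚ) : HomogUnit K :=
  ⟨b ^ f r * α r, r, mul_ne_zero (zpow_ne_zero _ hb) (h.ne_zero r)⟩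

lemma unit_eq (h : IsClassifiedBy V W A b f α) (hb : b ≠ 0) (r : ℚ) :
    h.unit hb r = const b hb ^ f r * ⟨α r, r, h.ne_zero r⟩ :=
  HomogUnit.ext (by simp [unit]) (by simp [unit])

@[simp] lemma coef_unit (h : IsClassifiedBy V W A b f α) (hb : b ≠ 0) (r : ℚ) :
    (h.unit hb r).coef = b ^ f r * α r := rfl

@[simp] lemma deg_unit (h : IsClassifiedBy V W A b f α) (hb : b ≠ 0) (r : ℚ) :
    (h.unit hb r).deg = r := rfl

lemma unit_zero (h : IsClassifiedBy V W A b f α) (hb : b ≠ 0) : h.unit hb 0 = 1 :=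
  HomogUnit.ext (by simp [h.1.1.1, h.1.2.2.1]) rfl

lemma normalizes_unit (h : IsClassifiedBy V W A b f α) {hb : b ≠ 0}
    (hC : ValCone degHom (cone W) (const b hb)) (r : ℚ) : Normalizes (cone W) (h.unit hb r) := by
  rw [unit_eq]
  exact (hC.gen_normalizes.zpow _).mul (normalizes_cone_iff.2 (h.1.2.2.2.2.1 r))

/-- The exponent of `b` is at most 0 by superadditivity, which yields closure under products; at
opposite degrees it is at least -1, which yields the inverse condition. -/
lemma assoc_unit_mul (h : IsClassifiedBy V W A b f α) {hb : b ≠ 0}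
    (hC : ValCone degHom (cone W) (const b hb)) (r s : ℚ) :
    Assoc (cone W) (h.unit hb r * h.unit hb s)
      (const b hb ^ (f r + f s - f (r + s)) * h.unit hb (r + s)) := by
  obtain ⟨a, ha⟩ : ∃ a : ℚ → HomogUnit K, ∀ r, a r = ⟨α r, r, h.ne_zero r⟩ := ⟨_, fun _ => rfl⟩
  have hau : ∀ r, h.unit hb r = const b hb ^ f r * a r := fun r => by rw [ha, unit_eq]
  have h1 : Normalizes (cone W) (a r) := by
    rw [ha]; exact normalizes_cone_iff.2 (h.1.2.2.2.2.1 r)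
  have h2 : Assoc (cone W) (a r * a s) (a (r + s)) := by
    rw [assoc_cone_iff (by simp [ha])]
    simpa [ha] using (h.1.2.2.2.2.2 r s).2
  have h3 := ((hC.assoc_gen_zpow_comm h1 (f s)).mul_right (a s)).mul_left
    (hC.gen_normalizes.zpow (f r))
  have h4 := h2.mul_left ((hC.gen_normalizes.zpow (f r)).mul (hC.gen_normalizes.zpow (f s)))
  rw [hau, hau, hau]
  simp only [mul_assoc] at h3 h4 ⊢
  have h5 := hC.assoc_trans h3 h4
  simp only [← mul_assoc, ← zpow_add] at h5 ⊢
  rwa [sub_add_cancel]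

lemma mul_unit_inv_mem (h : IsClassifiedBy V W A b f α) (hb : b ≠ 0) {v : HomogUnit K}
    (hv : v ∈ homogSet A) : v * (h.unit hb v.deg)⁻¹ ∈ cone W := by
  rw [mul_inv_mem_cone]
  refine ⟨rfl, (mem_rmulElt (h.unit hb v.deg).coef_ne).1 ?_⟩
  rw [coef_unit, ← h.1.2.2.2.1, ← one_mul v.coef]
  exact mul_mem_prodSet W.one_mem hv

lemma mul_mem_cone_of_le (hb : b ≠ 0) (hC : ValCone degHom (cone W) (const b hb))
    {x u : HomogUnit K} {d e : ℤ} (hde : d ≤ e) (hx : x * (const b hb ^ d * u)⁻¹ ∈ cone W) :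
    x * (const b hb ^ e * u)⁻¹ ∈ cone W := by
  have h1 := hC.mul hx (hC.gen_zpow_mem.2 (sub_nonpos.2 hde))
  have e1 : x * (const b hb ^ d * u)⁻¹ * const b hb ^ (d - e) =
      x * (const b hb ^ e * u)⁻¹ := by
    rw [zpow_sub]; group
  rwa [e1] at h1

lemma mul_mul_inv_mem (h : IsClassifiedBy V W A b f α) {hb : b ≠ 0}
    (hC : ValCone degHom (cone W) (const b hb)) {v w : HomogUnit K} (hv : v ∈ homogSet A)
    (hw : w ∈ homogSet A) {e : ℤ} (he : f v.deg + f w.deg - f (v.deg + w.deg) ≤ e) :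
    v * w * (const b hb ^ e * h.unit hb (v.deg + w.deg))⁻¹ ∈ cone W := by
  refine mul_mem_cone_of_le hb hC he ?_
  have h1 := (h.normalizes_unit hC v.deg _).2 (h.mul_unit_inv_mem hb hw)
  have h2 := hC.mul (hC.mul (h.mul_unit_inv_mem hb hv) h1) (h.assoc_unit_mul hC v.deg w.deg).1
  convert h2 using 1
  group

lemma mem_of_full (h : IsClassifiedBy V W A b f α) {hb : b ≠ 0} {v : HomogUnit K}
    (hr : (A v.deg : Set K) = rmulElt W (b ^ f v.deg * α v.deg)) :
    v ∈ homogSet A ↔ v * (h.unit hb v.deg)⁻¹ ∈ cone W := by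
  refine ⟨h.mul_unit_inv_mem hb, fun hv => ?_⟩
  rw [mul_inv_mem_cone] at hv
  rw [mem_homogSet, ← SetLike.mem_coe, hr]
  exact (mem_rmulElt (h.unit hb v.deg).coef_ne).2 hv.2

lemma mul_mem_of_full (h : IsClassifiedBy V W A b f α) {hb : b ≠ 0}
    (hC : ValCone degHom (cone W) (const b hb)) {v w : HomogUnit K} (hv : v ∈ homogSet A)
    (hw : w ∈ homogSet A) (hr : (A (v.deg + w.deg) : Set K) =
      rmulElt W (b ^ f (v.deg + w.deg) * α (v.deg + w.deg))) : v * w ∈ homogSet A := by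
  rw [h.mem_of_full (hb := hb) (by exact hr)]
  have := h.1.1.2.1 v.deg w.deg
  simpa using h.mul_mul_inv_mem hC hv hw (e := 0) (by omega)

lemma total_of_full (h : IsClassifiedBy V W A b f α) {hb : b ≠ 0}
    (hC : ValCone degHom (cone W) (const b hb)) (v : HomogUnit K)
    (hr : (A v.deg : Set K) = rmulElt W (b ^ f v.deg * α v.deg))
    (hr' : (A (-v.deg) : Set K) = rmulElt W (b ^ f (-v.deg) * α (-v.deg))) :
    v ∈ homogSet A ∨ v⁻¹ ∈ homogSet A := by
  rw [h.mem_of_full (hb := hb) hr, h.mem_of_full (v := v⁻¹) (hb := hb) hr', deg_inv]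
  refine or_iff_not_imp_left.2 fun hv => ?_
  have hj : (v * (h.unit hb v.deg)⁻¹)⁻¹ * const b hb ∈ cone W :=
    hC.nonunit_of_inv_notMem (by
      rw [degHom_eq_one_iff]; simp) (by simpa using hv)
  have h1 := (h.assoc_unit_mul hC v.deg (-v.deg)).2
  rw [add_neg_cancel, h.1.1.1, h.unit_zero, mul_one, sub_zero] at h1
  have h2 : const b hb ^ (-1 - (f v.deg + f (-v.deg))) ∈ cone W :=
    hC.gen_zpow_mem.2 (by have := h.1.1.2.2 v.deg; omega)
  have h3 := hC.mul (hC.mul hj h2) h1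
  rw [← (h.normalizes_unit hC v.deg).conj_inv] at h3
  convert h3 using 1
  rw [zpow_sub]
  group

lemma isGradedExtension_of_eq (h : IsClassifiedBy V W A b f α) {hb : b ≠ 0}
    (hC : ValCone degHom (cone W) (const b hb)) (hA0 : A 0 = V.toAddSubgroup) (hVW : W = V) :
    IsGradedExtension ⊤ V A := by
  have hfull : ∀ r, (A r : Set K) = rmulElt W (b ^ f r * α r) := fun r => by
    by_cases hr : r = 0
    · subst hr
      ext x
      rw [h.1.1.1, h.1.2.2.1, hA0, ← hVW, mem_rmulElt (by simp)]
      simp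
    · exact h.2.1 (.inl hVW) r hr
  exact isGradedExtension_iff.2 ⟨fun v hv w hw _ _ => h.mul_mem_of_full hC hv hw (hfull _),
    fun v _ => h.total_of_full hC v (hfull _) (hfull _), hA0⟩

lemma isGradedExtension_of_subgroup (h : IsClassifiedBy V W A b f α) {hb : b ≠ 0}
    (hC : ValCone degHom (cone W) (const b hb)) {G : AddSubgroup ℚ}
    (hG : ∀ r, r ∈ G ↔ f r + f (-r) = 0)
    (hfull : ∀ r, r ∉ G → (A r : Set K) = rmulElt W (b ^ f r * α r))
    (hGA : IsGradedExtension G V A)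
    (hsub : ∀ r ∈ G, rmulElt W (b ^ (f r - 1) * α r) ⊆ (A r : Set K)) :
    IsGradedExtension ⊤ V A := by
  rw [isGradedExtension_iff] at hGA ⊢
  refine ⟨fun v hv w hw _ _ => ?_, fun v _ => ?_, hGA.2.2⟩
  · by_cases hvw : v.deg + w.deg ∈ G
    swap
    · exact h.mul_mem_of_full hC hv hw (hfull _ hvw)
    by_cases hvG : v.deg ∈ G
    · exact hGA.1 v hv w hw hvG ((G.add_mem_cancel_left hvG).1 hvw)
    -- Translation by the total degree in `G` is additive for `f`, so the defect equals `f r + f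
    -- (-r)` with `r = v.deg` outside `G`. It is -1, which puts the product in the lower bound
    -- `hsub` for `A`.
    have hlt : f v.deg + f w.deg - f (v.deg + w.deg) ≤ -1 := by
      have h1 := h.1.1.map_add ((hG _).1 hvw) (-v.deg)
      rw [neg_add_cancel_left] at h1
      have h2 := (h.1.1.add_neg_eq v.deg).resolve_left fun h0 => hvG ((hG _).2 h0)
      omega
    have h1 := h.mul_mul_inv_mem hC hv hw hlt
    rw [mul_inv_mem_cone] at h1
    refine hsub _ hvw ((mem_rmulElt (mul_ne_zero (zpow_ne_zero _ hb) (h.ne_zero _))).2 ?_)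
    have e : (const b hb ^ (-1 : ℤ) * h.unit hb (v.deg + w.deg)).coef =
        b ^ (f (v.deg + w.deg) - 1) * α (v.deg + w.deg) := by
      rw [coef_mul, coef_const_zpow, deg_zpow, deg_const, mul_zero, zero_sg, coef_unit, ← mul_assoc,
        ← zpow_add₀ hb, neg_add_eq_sub]
    rw [← e]
    exact h1.2
  · by_cases hvG : v.deg ∈ G
    · exact hGA.2.1 v hvG
    · exact h.total_of_full hC v (hfull _ hvG) (hfull _ (by simpa using hvG))

lemma isGradedExtension (h : IsClassifiedBy V W A b f α) (hV : IsTotalValuationRing V)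
    (hVW : V ≤ W) {hb : b ≠ 0}
    (hC : ValCone degHom (cone W) (const b hb)) (hA0 : A 0 = V.toAddSubgroup) :
    IsGradedExtension ⊤ V A := by
  by_cases hWV : W = V
  · exact h.isGradedExtension_of_eq hC hA0 hWV
  -- The radical of `W` lies in `V`: the inverse of one of its nonzero elements is not in `W`, hence
  -- not in `V`. This is the lower bound at degree 0 when the exceptional subgroup is trivial.
  have hJV : ∀ w ∈ W, w * b⁻¹ ∈ V := fun w hw => by
    by_cases hw0 : w = 0
    · simp [hw0, V.zero_mem]
    refine (hV _ (mul_ne_zero hw0 (inv_ne_zero hb))).resolve_right fun hV' => ?_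
    rw [mul_inv_rev, inv_inv] at hV'
    have h2 : b ∈ W := by simpa [mul_assoc, hw0] using W.mul_mem (hVW hV') hw
    exact hC.gen_notMem ⟨rfl, h2⟩
  by_cases hex : ∃ r : ℚ, 0 < r ∧ f r + f (-r) = 0
  · obtain ⟨k, hk, hfull, hGA, hsub⟩ := h.2.2 ⟨hWV, hex⟩
    refine h.isGradedExtension_of_subgroup hC (fun r => (h.1.1.add_neg_eq_zero_iff hk).symm)
      hfull hGA fun r hr => ?_
    obtain ⟨j, rfl⟩ := hr
    simpa using (hsub j).1.1
  · push Not at hex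
    have hall : ∀ r, r ≠ 0 → f r + f (-r) = -1 := fun r hr => by
      refine (h.1.1.add_neg_eq r).resolve_left fun h0 => ?_
      rcases lt_or_gt_of_ne hr with hr | hr
      · exact hex (-r) (by linarith) (by rw [neg_neg]; omega)
      · exact hex r hr h0
    refine h.isGradedExtension_of_subgroup hC (G := ⊥) (fun r => ?_)
      (fun r hr => h.2.1 (.inr hall) r hr) ?_ fun r hr => ?_
    · rw [AddSubgroup.mem_bot]
      constructor
      · rintro rfl; simp [h.1.1.1]
      · intro h0
        by_contra hr
        have := hall r hr
        omega
    · refine isGradedExtension_iff.2 ⟨fun v hv w hw hvG hwG => ?_, fun v hvG => ?_, hA0⟩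
      · rw [AddSubgroup.mem_bot] at hvG hwG
        rw [mem_homogSet, hvG, hA0] at hv
        rw [mem_homogSet, hwG, hA0] at hw
        rw [mem_homogSet, deg_mul, hvG, hwG, add_zero, hA0, coef_mul, hvG, zero_sg]
        exact V.mul_mem hv hw
      · rw [AddSubgroup.mem_bot] at hvG
        rw [mem_homogSet, mem_homogSet, deg_inv, coef_inv, hvG, neg_zero, zero_sg, hA0]
        exact hV _ v.coef_ne
    · rw [AddSubgroup.mem_bot] at hr
      subst hr
      rintro _ ⟨w, hw, rfl⟩
      rw [h.1.1.1, h.1.2.2.1, hA0]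
      simpa using hJV w hw

/-- If `A_g A_k^{σ(g)} = A_{g+k}`, then `f` is additive at `(g, k)`. -/
lemma map_add_of_prodSet_eq (h : IsClassifiedBy V W A b f α) {hb : b ≠ 0}
    (hC : ValCone degHom (cone W) (const b hb)) {g k : ℚ}
    (hgk : prodSet (A g) (sgSet g (A k)) = (A (g + k) : Set K)) : f (g + k) = f g + f k := by
  by_contra hne
  have hle := h.1.1.2.1 g k
  -- If additivity fails, every product loses at least one factor of `b`, so `W A_{g+k}` would lie
  -- in `W y`. That module misses the generator, since `b ∉ W`.
  obtain ⟨y, hy⟩ : ∃ y, y = const b hb ^ (-1 : ℤ) * h.unit hb (g + k) := ⟨_, rfl⟩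
  have hsub : (A (g + k) : Set K) ⊆ rmulElt (W : Set K) y.coef := by
    rw [← hgk]
    refine prodSet_subset (I := rmulSubgroup W y.coef) ?_
    rintro x hx _ ⟨z, hz, rfl⟩
    by_cases hx0 : x = 0
    · simp [hx0, (rmulSubgroup W y.coef).zero_mem]
    by_cases hz0 : z = 0
    · simp [hz0, (rmulSubgroup W y.coef).zero_mem]
    have h1 := h.mul_mul_inv_mem hC (v := ⟨x, g, hx0⟩) (w := ⟨z, k, hz0⟩) hx hz (e := -1)
      (by show f g + f k - f (g + k) ≤ -1; omega)
    have h2 := mul_inv_mem_cone.1 h1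
    exact (mem_rmulElt (x := x * sg g z) y.coef_ne).2 (by rw [hy]; exact h2.2)
  have h3 : prodSet W (A (g + k)) ⊆ rmulElt (W : Set K) y.coef := by
    refine prodSet_subset (I := rmulSubgroup W y.coef) fun w hw x hx => ?_
    obtain ⟨w', hw', rfl⟩ := hsub hx
    exact (⟨w * w', W.mul_mem hw hw', by rw [mul_assoc]⟩ :
      w * (w' * y.coef) ∈ rmulElt (W : Set K) y.coef)
  rw [h.1.2.2.2.1] at h3
  have h4 : (h.unit hb (g + k)).coef ∈ rmulElt (W : Set K) y.coef :=
    h3 ⟨1, W.one_mem, by simp⟩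
  rw [mem_rmulElt y.coef_ne] at h4
  have h5 : h.unit hb (g + k) * y⁻¹ ∈ cone W :=
    mul_inv_mem_cone.2 ⟨by simp [hy], h4⟩
  have e : h.unit hb (g + k) * y⁻¹ = const b hb := by rw [hy]; group
  exact hC.gen_notMem (e ▸ h5)

lemma isTypeE (h : IsClassifiedBy V W A b f α) (hV : IsTotalValuationRing V)
    (hW : (W : Set K) = ⋃ r, (leftOrder (A r) : Set K)) {hb : b ≠ 0}
    (hC : ValCone degHom (cone W) (const b hb)) (hJ : jac W = rmulElt W b⁻¹)
    (hA0 : A 0 = V.toAddSubgroup) : IsTypeE V A := by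
  have hA := h.isGradedExtension hV (le_of_eq_iUnion_leftOrder hA0 hW) hC hA0
  obtain ⟨g, k, hg, hk, hgk⟩ : ∃ g k : ℚ, 0 < g ∧ 0 < k ∧
      (prodSet (A g) (sgSet g (A k)) ≠ (A (g + k) : Set K) ∨
        prodSet (A (-g)) (sgSet (-g) (A (-k))) ≠ (A (-g - k) : Set K)) := by
    by_contra hcon
    push Not at hcon
    refine h.1.2.1 (h.1.1.eq_zero_of_additive fun r s hr hs => ?_)
    have h1 := hcon r s hr hs
    refine ⟨h.map_add_of_prodSet_eq hC h1.1, ?_⟩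
    rw [sub_eq_add_neg] at h1 ⊢
    exact h.map_add_of_prodSet_eq hC h1.2
  have hgd := g.den_pos.ne'
  have hkd := k.den_pos.ne'
  -- Both `g` and `k` are integer multiples of this step, so the failing equality already occurs in
  -- one `H_r`.
  refine ⟨hA, 1 / ((g.den : ℚ) * k.den), by
    have := g.den_pos
    have := k.den_pos
    positivity, ⟨hA.mono_subgroup, g, ⟨g.num * k.den, ?_⟩, k, ⟨k.num * g.den, ?_⟩, hg, hk, hgk⟩,
    W, hW, b, hb, ?_⟩
  · simp only [zsmul_eq_mul]
    conv_rhs => rw [← Rat.num_div_den g]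
    push_cast
    field_simp
  · simp only [zsmul_eq_mul]
    conv_rhs => rw [← Rat.num_div_den k]
    push_cast
    field_simp
  · have h1 := normalizes_cone_iff.1 hC.gen_normalizes.inv
    have h2 : sgSet 0 (W : Set K) = W := by
      ext x; simp [mem_sgSet]
    simp only [coef_inv, deg_inv, deg_const, neg_zero, zero_sg, coef_const, h2] at h1
    rw [hJ, h1]

end IsClassifiedBy

end Skew

end GradedExt

open GradedExt
theorem theorem4p14 {K : Type*} [DivisionRing K] [MulSemiringAction (Multiplicative ℚ) K]
    (V : Subring K) (hV : IsTotalValuationRing V) (hVK : V ≠ ⊤)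
    (A : ℚ → AddSubgroup K) (hA0 : A 0 = V.toAddSubgroup)
    (W : Subring K) (hW : (W : Set K) = ⋃ r, (leftOrder (A r) : Set K))
    (b : K) (hb : b ≠ 0) (hJ : jac W = rmulElt W b⁻¹)
    (ht : ∃ t : ℚ, leftOrder (A t) = W)
    (hfin : IsTypeE V A → ∃ m : ℚ, 0 < m ∧ (lSup V W b A m < ⊤ ∨ kSup V W b A m < ⊤)) :
    IsTypeE V A ↔
      ∃ (f : ℚ → ℤ) (α : ℚ → K),
        -- the map `f` and the elements `α_r`
        (IsGradedMap f ∧ f ≠ 0 ∧ α 0 = 1 ∧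
          (∀ r, prodSet W (A r) = rmulElt W (b ^ f r * α r)) ∧
          (∀ r, rmulElt (W : Set K) (α r) = lmulElt (α r) (sgSet r W)) ∧
          (∀ r s,
            prodSet (rmulElt W (α r)) (sgSet r (rmulElt W (α s))) =
                rmulElt W (α r * sg r (α s)) ∧
              rmulElt (W : Set K) (α r * sg r (α s)) = rmulElt W (α (r + s)))) ∧
        -- first case
        ((W = V ∨ ∀ r, r ≠ 0 → f r + f (-r) = -1) →
          ∀ r, r ≠ 0 → (A r : Set K) = rmulElt W (b ^ f r * α r)) ∧
        -- second case
        ((W ≠ V ∧ ∃ r : ℚ, 0 < r ∧ f r + f (-r) = 0) →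
          ∃ k : ℚ, IsLeast {r : ℚ | 0 < r ∧ f r + f (-r) = 0} k ∧
            (∀ r, r ∉ AddSubgroup.zmultiples k → (A r : Set K) = rmulElt W (b ^ f r * α r)) ∧
            IsGradedExtension (AddSubgroup.zmultiples k) V A ∧
            ∀ j : ℤ,
              rmulElt W (b ^ (f (j * k) - 1) * α (j * k)) ⊂ (A (j * k) : Set K) ∧
              (A (j * k) : Set K) ⊂ rmulElt W (b ^ f (j * k) * α (j * k))) := by
  have hWt := hV.mono (le_of_eq_iUnion_leftOrder hA0 hW)
  constructor
  · intro hE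
    obtain ⟨β, ε, hβ⟩ := (gradedCone hV hE.1 hW hb hJ ht).exists_isTopSystem
    have hD : ExtData V W A b hb β ε := ⟨hβ, hWt, hE.1, hJ⟩
    obtain ⟨t, htε⟩ := hD.exists_eq_one hE
    obtain ⟨m, hm, hfin⟩ := hfin hE
    obtain ⟨f, hf⟩ := hD.exists_splitting htε hm hfin
    exact ⟨f, fun r => b ^ (-f r) * (β r).coef, hD.isClassifiedBy htε hf⟩
  · rintro ⟨f, α, h⟩
    exact IsClassifiedBy.isTypeE h hV hW (valCone hWt hb hJ) hJ hA0
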